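/- For $P(t)=a_mt^m+\dots+a_0\in\mathbb Z[t]$ let $H(P)=\max_j|a_j|$, and let $\mathcal P_n(Q)$ be the set of $P\in\mathbb Z[t]$ with $\deg P\le n$ and $H(P)\le Q$. Let $\mu_1,\mu_2$ denote Lebesgue measure on $\mathbb R$ and $\mathbb R^2$. Let $n\ge 2$ be an integer, $\varepsilon>0$, $\mathbf d=(d_1,d_2)\in\mathbb R^2$ and $h_n>0$. There are constants $c_0>0$ and $\delta_0>0$, depending only on $n,\varepsilon,\mathbf d$ and $h_n$, such that the following holds. Let $s_1,s_2<1$ be real numbers with $0<s_1+s_2\le 1$, let $v_1,v_2>0$ with $v_1+v_2=n-1$, and let $c_{1,1},c_{1,2}>0$, where $c_{1,1}c_{1,2}>c_0$ if $s_1+s_2=1$. Then there is $Q_0$, depending only on $n,\varepsilon,\mathbf d,h_n,s_1,s_2,v_1,v_2,c_{1,1},c_{1,2}$, such that for every real $Q>Q_0$, every $\delta_n\le\delta_0$ and every rectangle $\Pi=I_1\times I_2$ with midpoint $\mathbf d$ whose sides are intervals with $\mu_1I_i=c_{1,i}Q^{-s_i}$ $(i=1,2)$ and which satisfies $\Pi\cap\{(x_1,x_2)\in\mathbb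 R^2:|x_1-x_2|<\varepsilon\}=\emptyset$, the set $L$ of points $(x_1,x_2)\in\Pi$ for which there is a nonzero $P\in\mathcal P_n(Q)$ with $$|P(x_1)|<h_nQ^{-v_1},\qquad |P(x_2)|<h_nQ^{-v_2},\qquad \min\{|P'(x_1)|,|P'(x_2)|\}<\delta_nQ$$ has measure $\mu_2L<\tfrac14\,\mu_2\Pi$. -/

import Mathlib

open Polynomial MeasureTheory

/-- The height of an integer polynomial: the maximum of the absolute values of its coefficients. -/
def polyHeight (P : ℤ[X]) : ℕ :=
  (Finset.range (P.natDegree + 1)).sup fun j => (P.coeff j).natAbs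

/-- The integer polynomials of degree at most `n` and of height at most `Q`. -/
def polyClass (n : ℕ) (Q : ℝ) : Set ℤ[X] :=
  {P | P.natDegree ≤ n ∧ (polyHeight P : ℝ) ≤ Q}

/-- `I` is a bounded interval (open, closed or half-open) with midpoint `d` and length `l`. -/
def IsIntervalWith (I : Set ℝ) (d l : ℝ) : Prop :=
  Set.Ioo (d - l / 2) (d + l / 2) ⊆ I ∧ I ⊆ Set.Icc (d - l / 2) (d + l / 2)

/-- The points `(x₁, x₂)` of `R` at which some nonzero `P` of degree at most `n` and height at most
`Q` satisfies `|P(xᵢ)| < h Q ^ (-vᵢ)` for `i = 1, 2` and `min (|P'(x₁)|, |P'(x₂)|) < δ Q`. -/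
def smallDerivSet (n : ℕ) (Q h δ v₁ v₂ : ℝ) (R : Set (ℝ × ℝ)) : Set (ℝ × ℝ) :=
  {x | x ∈ R ∧ ∃ P ∈ polyClass n Q, P ≠ 0 ∧
    |aeval x.1 P| < h * Q ^ (-v₁) ∧ |aeval x.2 P| < h * Q ^ (-v₂) ∧
    min |aeval x.1 (derivative P)| |aeval x.2 (derivative P)| < δ * Q}

/-! The proof is quantitative nondivergence in the manner of Kleinbock and Margulis. Map P to the
vector of P(x₁), P(x₂), P'(s), with s one of x₁, x₂, and all coefficients of P, weighted by η times
Q^v₁, Q^v₂, 1/(δ₀Q) and 1/Q. A point of L carries, for one of the two choices of s, a nonzero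
integer polynomial whose vector has all entries below σ (`smallDerivSet_diff_subset`). Such points
fill a small proportion of the rectangle (`exists_volume_short_le`), provided every independent
family of integer polynomials of degree at most n has, somewhere on the rectangle, a minor of
absolute value at least 1.

This condition is checked by rank (`exists_one_le_minorNorm_column`). In rank 1, no root is near
both d₁ and d₂, so P cannot be small to high order on both sides. In ranks 2 to n, an echelon basis
reduces a suitable minor to p(x)q(y) - q(x)p(y), which has the factor x - y. In rank n + 1 the minor
is a confluent Vandermonde determinant (x - y)² and all powers of Q cancel, which fixes δ₀. In the
lower ranks the power of Q that appears has nonnegative exponent, and exponent 0 forces s₁ + s₂ = 1;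
there c₁c₂ > c₀ is needed.

Nondivergence itself rests on two facts. A function polynomial in each variable that is large
somewhere on a cell is small only on a small part of it (`exists_volume_prod_small_le`). A stopping
argument on dyadic cells (`measure_not_isMarked_inter_le`) then gives most points a chain of
rational subspaces of controlled covolume, and such a chain excludes short vectors
(`le_minorNorm_of_isMarked`). -/

/-! ### Polynomials in one variable: size in terms of the distance to the roots. -/

theorem abs_eval_eq_prod_aroots (p : ℝ[X]) (x : ℝ) :
    |p.eval x| = |p.leadingCoeff| * ((p.aroots ℂ).map fun α => ‖(x : ℂ) - α‖).prod := by
  have h := (IsAlgClosed.splits (p.map (algebraMap ℝ ℂ))).aeval_eq_prod_aroots (x : ℂ)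
  have h2 : (aeval (x : ℂ)) p = ((p.eval x : ℝ) : ℂ) := by
    have := aeval_algebraMap_apply ℂ x p
    simpa using this
  rw [h2] at h
  have h3 := congrArg norm h
  rw [Complex.norm_real, Real.norm_eq_abs, norm_mul, norm_algebraMap', Real.norm_eq_abs] at h3
  rw [h3]
  congr 1
  generalize p.aroots ℂ = s
  induction s using Multiset.induction_on with
  | empty => simp
  | cons a s ih => simp [ih]

theorem volume_near_le (s : Multiset ℂ) (r : ℝ) :
    volume {x : ℝ | ∃ α ∈ s, ‖(x : ℂ) - α‖ < r} ≤ s.card * ENNReal.ofReal (2 * r) := by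
  induction s using Multiset.induction_on with
  | empty => simp
  | cons a s ih =>
    have hsub : {x : ℝ | ∃ α ∈ a ::ₘ s, ‖(x : ℂ) - α‖ < r} ⊆
        Metric.ball a.re r ∪ {x : ℝ | ∃ α ∈ s, ‖(x : ℂ) - α‖ < r} := by
      rintro x ⟨α, hα, hx⟩
      rcases Multiset.mem_cons.1 hα with rfl | hα
      · left
        rw [Metric.mem_ball, Real.dist_eq]
        have := Complex.abs_re_le_norm ((x : ℂ) - α)
        simp only [Complex.sub_re, Complex.ofReal_re] at this
        exact this.trans_lt hx
      · exact Or.inr ⟨α, hα, hx⟩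
    calc _ ≤ volume (Metric.ball a.re r) + volume {x : ℝ | ∃ α ∈ s, ‖(x : ℂ) - α‖ < r} :=
          (measure_mono hsub).trans (measure_union_le _ _)
      _ ≤ ENNReal.ofReal (2 * r) + s.card * ENNReal.ofReal (2 * r) := by
          rw [Real.volume_ball]
          gcongr
      _ = _ := by
          rw [Multiset.card_cons]
          push_cast
          ring

theorem card_aroots_le (p : ℝ[X]) : (p.aroots ℂ).card ≤ p.natDegree :=
  (card_roots' _).trans natDegree_map_le

/-- A polynomial that is large somewhere on an interval is not much smaller on most of it. -/
theorem exists_volume_small_le (d : ℕ) {τ : ℝ} (hτ : 0 < τ) :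
    ∃ t : ℝ, 0 < t ∧ t ≤ 1 ∧ ∀ p : ℝ[X], p.natDegree ≤ d → ∀ u w c : ℝ, 0 < w → 0 < c →
      (∃ y ∈ Set.Ico u (u + w), c ≤ |p.eval y|) →
      volume {x ∈ Set.Ico u (u + w) | |p.eval x| < t * c} ≤ ENNReal.ofReal (τ * w) := by
  -- With r = τw/(2(d+1)) this is 1 + w/r. If x is at distance at least r from a root α, then |y -
  -- α| ≤ w + |x - α| ≤ q|x - α|. The r-neighbourhoods of the at most d roots have total length at
  -- most τw.
  set q : ℝ := 1 + 2 * (d + 1) / τ with hq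
  have hq1 : 1 ≤ q := by
    have : 0 ≤ 2 * ((d : ℝ) + 1) / τ := by positivity
    linarith
  have hq0 : 0 < q := by linarith
  refine ⟨(q ^ d)⁻¹, by positivity, inv_le_one_of_one_le₀ (one_le_pow₀ hq1), ?_⟩
  rintro p hp u w c hw hc ⟨y, hy, hcy⟩
  set r : ℝ := τ * w / (2 * (d + 1)) with hr
  have hr0 : 0 < r := by positivity
  have hqr : q = 1 + w / r := by
    rw [hq, hr]
    field_simp
  have hcard : (p.aroots ℂ).card ≤ d := (card_aroots_le p).trans hp
  have hsub : {x ∈ Set.Ico u (u + w) | |p.eval x| < (q ^ d)⁻¹ * c} ⊆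
      {x : ℝ | ∃ α ∈ p.aroots ℂ, ‖(x : ℂ) - α‖ < r} := by
    rintro x ⟨hx, hxc⟩
    by_contra hno
    simp only [Set.mem_ofPred_eq, not_exists, not_and, not_lt] at hno
    have hxy : ‖(y : ℂ) - x‖ ≤ w := by
      rw [← Complex.ofReal_sub, Complex.norm_real, Real.norm_eq_abs, abs_le]
      constructor <;> linarith [hx.1, hx.2, hy.1, hy.2]
    have hprod : ((p.aroots ℂ).map fun α => ‖(y : ℂ) - α‖).prod ≤
        q ^ (p.aroots ℂ).card * ((p.aroots ℂ).map fun α => ‖(x : ℂ) - α‖).prod := by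
      rw [← Multiset.prod_replicate, ← Multiset.map_const', ← Multiset.prod_map_mul]
      refine Multiset.prod_map_le_prod_map₀ _ _ (fun α _ => norm_nonneg _) fun α hα => ?_
      have h1 := hno α hα
      calc ‖(y : ℂ) - α‖ = ‖((y : ℂ) - x) + (x - α)‖ := by ring_nf
        _ ≤ w + ‖(x : ℂ) - α‖ := (norm_add_le _ _).trans (by linarith)
        _ ≤ q * ‖(x : ℂ) - α‖ := by
          have : w ≤ w / r * ‖(x : ℂ) - α‖ := by
            rw [div_mul_eq_mul_div, le_div_iff₀ hr0]
            exact mul_le_mul_of_nonneg_left h1 hw.le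
          rw [hqr]
          linarith
    have hpx0 : 0 ≤ ((p.aroots ℂ).map fun α => ‖(x : ℂ) - α‖).prod :=
      Multiset.prod_nonneg (by simp only [Multiset.mem_map]; rintro _ ⟨α, -, rfl⟩; positivity)
    have : c ≤ q ^ d * |p.eval x| := by
      refine hcy.trans ?_
      rw [abs_eval_eq_prod_aroots p y, abs_eval_eq_prod_aroots p x]
      calc _ ≤ |p.leadingCoeff| * (q ^ (p.aroots ℂ).card *
            ((p.aroots ℂ).map fun α => ‖(x : ℂ) - α‖).prod) := by gcongr
        _ ≤ |p.leadingCoeff| * (q ^ d * ((p.aroots ℂ).map fun α => ‖(x : ℂ) - α‖).prod) := by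
          gcongr
        _ = _ := by ring
    have h5 : |p.eval x| * q ^ d < c := by
      rwa [inv_mul_eq_div, lt_div_iff₀ (by positivity)] at hxc
    linarith
  refine (measure_mono hsub).trans ((volume_near_le _ _).trans ?_)
  rw [← ENNReal.ofReal_natCast, ← ENNReal.ofReal_mul (by positivity)]
  apply ENNReal.ofReal_le_ofReal
  calc ((p.aroots ℂ).card : ℝ) * (2 * r) ≤ (d + 1) * (2 * r) := by
        gcongr
        exact_mod_cast hcard.trans (Nat.le_succ d)
    _ = τ * w := by
        rw [hr]
        field_simp

/-- The discs of radius l/(2n+2) about n points meet the line in total length at most l·n/(n+1) < l.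
-/
theorem exists_far_from_multiset (s : Multiset ℂ) {n : ℕ} (hs : s.card ≤ n) (u : ℝ) {l : ℝ}
    (hl : 0 < l) : ∃ x ∈ Set.Ioo u (u + l), ∀ α ∈ s, l / (2 * n + 2) ≤ ‖(x : ℂ) - α‖ := by
  by_contra hno
  push Not at hno
  have h := (measure_mono (μ := volume) hno).trans (volume_near_le s (l / (2 * n + 2)))
  rw [Real.volume_Ioo, ← ENNReal.ofReal_natCast, ← ENNReal.ofReal_mul (by positivity),
    ENNReal.ofReal_le_ofReal_iff (by positivity)] at h
  have h2 : (s.card : ℝ) * (2 * (l / (2 * n + 2))) ≤ n * (2 * (l / (2 * n + 2))) := by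
    gcongr
  have h3 : (n : ℝ) * (2 * (l / (2 * n + 2))) < l := by
    have h4 : (n : ℝ) * (2 * (l / (2 * n + 2))) = l * (n / (n + 1)) := by field_simp
    rw [h4]
    have : (n : ℝ) / (n + 1) < 1 := by
      rw [div_lt_one (by positivity)]
      linarith
    nlinarith
  linarith

/-- On an interval of length `l` a polynomial reaches the size `|a| (l / (2 n + 2)) ^ k`, where `a`
is the leading coefficient and `k` the degree. -/
theorem exists_leadingCoeff_mul_le_abs_eval (p : ℝ[X]) {n : ℕ} (hp : p.natDegree ≤ n) (u : ℝ)
    {l : ℝ} (hl : 0 < l) : ∃ x ∈ Set.Ioo u (u + l),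
      |p.leadingCoeff| * (l / (2 * n + 2)) ^ p.natDegree ≤ |p.eval x| := by
  obtain ⟨x, hx, hfar⟩ := exists_far_from_multiset (p.aroots ℂ) ((card_aroots_le p).trans hp) u hl
  refine ⟨x, hx, ?_⟩
  rw [abs_eval_eq_prod_aroots]
  gcongr
  have hcard : (p.aroots ℂ).card = p.natDegree := by
    rw [aroots, ← (IsAlgClosed.splits (p.map (algebraMap ℝ ℂ))).natDegree_eq_card_roots,
      natDegree_map]
  rw [← hcard, ← Multiset.prod_replicate, ← Multiset.map_const']
  exact Multiset.prod_map_le_prod_map₀ _ _ (fun α _ => by positivity) hfar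

/-- Evaluate at a point x far from all roots. A root within ε/2 of d contributes a factor of order
l. Any other root contributes a constant: if l ≤ ε/2 its distance from x is at least ε/2 - l/2 ≥
ε/4, and otherwise l/(2n+2) is already large enough. -/
theorem exists_pow_countP_le_abs_eval (p : ℝ[X]) {n : ℕ} (hp : p.natDegree ≤ n)
    (hlc : 1 ≤ |p.leadingCoeff|) (d : ℝ) {ε : ℝ} (hε : 0 < ε) {l : ℝ} (hl : 0 < l) :
    ∃ x ∈ Set.Ioo (d - l / 2) (d + l / 2),
      (min 1 ε / (4 * (n + 1))) ^ n *
        l ^ (p.aroots ℂ).countP (fun α => ‖(d : ℂ) - α‖ < ε / 2) ≤ |p.eval x| := by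
  classical
  have hcard := (card_aroots_le p).trans hp
  obtain ⟨x, hx, hfar⟩ := exists_far_from_multiset (p.aroots ℂ) hcard (d - l / 2) hl
  have hx' : x ∈ Set.Ioo (d - l / 2) (d + l / 2) := ⟨hx.1, by linarith [hx.2]⟩
  refine ⟨x, hx', ?_⟩
  set c : ℝ := min 1 ε / (4 * (n + 1)) with hc
  have hm0 : 0 < min 1 ε := lt_min one_pos hε
  have hc0 : 0 < c := by positivity
  have hc1 : c ≤ 1 := by
    rw [hc, div_le_one (by positivity)]
    have : (0 : ℝ) ≤ n := by positivity
    linarith [min_le_left 1 ε]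
  have hprod : ((p.aroots ℂ).map fun α : ℂ => c * if ‖(d : ℂ) - α‖ < ε / 2 then l else 1).prod ≤
      ((p.aroots ℂ).map fun α => ‖(x : ℂ) - α‖).prod := by
    refine Multiset.prod_map_le_prod_map₀ _ _ (fun α _ => by split_ifs <;> positivity)
      fun α hα => ?_
    have h1 := hfar α hα
    split_ifs with hnear
    · refine le_trans ?_ h1
      rw [hc, div_mul_eq_mul_div, div_le_div_iff₀ (by positivity) (by positivity)]
      have : min 1 ε * l ≤ 1 * l := by
        gcongr
        exact min_le_left _ _
      nlinarith [mul_nonneg hl.le (Nat.cast_nonneg (α := ℝ) n)]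
    · have h2 : c ≤ ε / (4 * (n + 1)) := by
        rw [hc]
        gcongr
        exact min_le_right _ _
      rw [mul_one]
      refine h2.trans ?_
      by_cases hle : l ≤ ε / 2
      · have h3 : ‖(d : ℂ) - x‖ ≤ l / 2 := by
          rw [← Complex.ofReal_sub, Complex.norm_real, Real.norm_eq_abs, abs_le]
          constructor <;> linarith [hx'.1, hx'.2]
        have h4 : ‖(d : ℂ) - α‖ ≤ ‖(d : ℂ) - x‖ + ‖(x : ℂ) - α‖ := by
          simpa using norm_add_le ((d : ℂ) - x) (x - α)
        have h5 : ε / (4 * (n + 1)) ≤ ε / 4 := by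
          apply div_le_div_of_nonneg_left hε.le (by norm_num)
          have : (0 : ℝ) ≤ n := by positivity
          linarith
        linarith
      · refine le_trans ?_ h1
        rw [div_le_div_iff₀ (by positivity) (by positivity)]
        have : (0 : ℝ) ≤ n := by positivity
        nlinarith
  rw [Multiset.prod_map_mul, Multiset.map_const', Multiset.prod_replicate] at hprod
  have hite : ((p.aroots ℂ).map fun α : ℂ => if ‖(d : ℂ) - α‖ < ε / 2 then l else 1).prod =
      l ^ (p.aroots ℂ).countP (fun α => ‖(d : ℂ) - α‖ < ε / 2) := by
    generalize p.aroots ℂ = s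
    induction s using Multiset.induction_on with
    | empty => simp
    | cons a s ih =>
      rw [Multiset.map_cons, Multiset.prod_cons, ih, Multiset.countP_cons]
      split_ifs <;> ring
  rw [hite] at hprod
  rw [abs_eval_eq_prod_aroots]
  calc _ ≤ c ^ (p.aroots ℂ).card *
        l ^ (p.aroots ℂ).countP (fun α => ‖(d : ℂ) - α‖ < ε / 2) := by
        gcongr ?_ * _
        exact pow_le_pow_of_le_one hc0.le hc1 hcard
    _ ≤ _ := hprod
    _ ≤ _ := le_mul_of_one_le_left
        (Multiset.prod_nonneg
          (by simp only [Multiset.mem_map]; rintro _ ⟨α, -, rfl⟩; positivity)) hlc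

/-- A polynomial whose leading coefficient is at least `1` cannot be small both near `d₁` and near
`d₂` to an order exceeding its degree in total. -/
theorem exists_orders_le_abs_eval (p : ℝ[X]) {n : ℕ} (hp : p.natDegree ≤ n)
    (hlc : 1 ≤ |p.leadingCoeff|) {d₁ d₂ ε : ℝ} (hε : 0 < ε) (hd : ε ≤ |d₁ - d₂|) :
    ∃ k₁ k₂ : ℕ, k₁ + k₂ ≤ n ∧
      (∀ l > 0, ∃ x ∈ Set.Ioo (d₁ - l / 2) (d₁ + l / 2),
        (min 1 ε / (4 * (n + 1))) ^ n * l ^ k₁ ≤ |p.eval x|) ∧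
      (∀ l > 0, ∃ x ∈ Set.Ioo (d₂ - l / 2) (d₂ + l / 2),
        (min 1 ε / (4 * (n + 1))) ^ n * l ^ k₂ ≤ |p.eval x|) := by
  classical
  refine ⟨_, _, ?_, fun l hl => exists_pow_countP_le_abs_eval p hp hlc d₁ hε hl,
    fun l hl => exists_pow_countP_le_abs_eval p hp hlc d₂ hε hl⟩
  refine le_trans ?_ ((card_aroots_le p).trans hp)
  generalize p.aroots ℂ = s
  induction s using Multiset.induction_on with
  | empty => simp
  | cons a s ih =>
    rw [Multiset.countP_cons, Multiset.countP_cons, Multiset.card_cons]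
    have : ¬ (‖(d₁ : ℂ) - a‖ < ε / 2 ∧ ‖(d₂ : ℂ) - a‖ < ε / 2) := by
      rintro ⟨h1, h2⟩
      have h3 : ‖(d₁ : ℂ) - d₂‖ ≤ ‖(d₁ : ℂ) - a‖ + ‖(d₂ : ℂ) - a‖ := by
        simpa using norm_sub_le ((d₁ : ℂ) - a) (d₂ - a)
      rw [← Complex.ofReal_sub, Complex.norm_real, Real.norm_eq_abs] at h3
      linarith
    split_ifs with h1 h2 h2
    · exact absurd ⟨h1, h2⟩ this
    all_goals omega

/-! ### Functions on the plane that are polynomial in each variable. -/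

/-- `f` is given by a real polynomial of degree at most `d`. -/
def IsPolyFun (d : ℕ) (f : ℝ → ℝ) : Prop :=
  ∃ p : ℝ[X], p.natDegree ≤ d ∧ ∀ x, f x = p.eval x

theorem IsPolyFun.mono {d e : ℕ} {f : ℝ → ℝ} (hf : IsPolyFun d f) (hde : d ≤ e) :
    IsPolyFun e f := by
  obtain ⟨p, hp, h⟩ := hf
  exact ⟨p, hp.trans hde, h⟩

theorem isPolyFun_const (d : ℕ) (c : ℝ) : IsPolyFun d fun _ => c :=
  ⟨C c, by simp, by simp⟩

theorem isPolyFun_eval (p : ℝ[X]) {d : ℕ} (hp : p.natDegree ≤ d) : IsPolyFun d fun x => p.eval x :=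
  ⟨p, hp, fun _ => rfl⟩

theorem IsPolyFun.mul {d e : ℕ} {f g : ℝ → ℝ} (hf : IsPolyFun d f) (hg : IsPolyFun e g) :
    IsPolyFun (d + e) fun x => f x * g x := by
  obtain ⟨p, hp, h⟩ := hf
  obtain ⟨q, hq, h'⟩ := hg
  exact ⟨p * q, natDegree_mul_le.trans (add_le_add hp hq), fun x => by simp [h, h']⟩

theorem isPolyFun_sum {ι : Type*} (s : Finset ι) {d : ℕ} {f : ι → ℝ → ℝ}
    (hf : ∀ i ∈ s, IsPolyFun d (f i)) : IsPolyFun d fun x => ∑ i ∈ s, f i x := by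
  classical
  induction s using Finset.induction_on with
  | empty => simpa using isPolyFun_const d 0
  | insert a s ha ih =>
    obtain ⟨p, hp, h⟩ := hf a (Finset.mem_insert_self a s)
    obtain ⟨q, hq, h'⟩ := ih fun i hi => hf i (Finset.mem_insert_of_mem hi)
    exact ⟨p + q, (natDegree_add_le _ _).trans (max_le hp hq), fun x => by
      simp only [Finset.sum_insert ha, eval_add, h, ← h']⟩

theorem isPolyFun_prod {ι : Type*} (s : Finset ι) {d : ℕ} {f : ι → ℝ → ℝ}
    (hf : ∀ i ∈ s, IsPolyFun d (f i)) : IsPolyFun (s.card * d) fun x => ∏ i ∈ s, f i x := by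
  classical
  induction s using Finset.induction_on with
  | empty => simpa using isPolyFun_const _ 1
  | insert a s ha ih =>
    have := (hf a (Finset.mem_insert_self a s)).mul
      (ih fun i hi => hf i (Finset.mem_insert_of_mem hi))
    rw [Finset.card_insert_of_notMem ha]
    simp only [Finset.prod_insert ha]
    exact this.mono (le_of_eq (by ring))

theorem isPolyFun_det {j d : ℕ} {M : ℝ → Matrix (Fin j) (Fin j) ℝ}
    (hM : ∀ a b, IsPolyFun d fun x => M x a b) : IsPolyFun (j * d) fun x => (M x).det := by
  simp only [Matrix.det_apply']
  refine isPolyFun_sum _ fun σ _ => ?_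
  have h := isPolyFun_prod Finset.univ (f := fun i x => M x (σ i) i) fun i _ => hM (σ i) i
  have := (isPolyFun_const 0 ((Equiv.Perm.sign σ : ℤ) : ℝ)).mul h
  simpa using this

/-- `G` is continuous and a polynomial of degree at most `d` in each of its two variables. -/
structure IsBiPolyFun (d : ℕ) (G : ℝ × ℝ → ℝ) : Prop where
  fst : ∀ y, IsPolyFun d fun x => G (x, y)
  snd : ∀ x, IsPolyFun d fun y => G (x, y)
  continuous : Continuous G

theorem IsBiPolyFun.mono {d e : ℕ} {G : ℝ × ℝ → ℝ} (hG : IsBiPolyFun d G) (hde : d ≤ e) :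
    IsBiPolyFun e G :=
  ⟨fun y => (hG.fst y).mono hde, fun x => (hG.snd x).mono hde, hG.continuous⟩

theorem IsBiPolyFun.const_mul {d : ℕ} {G : ℝ × ℝ → ℝ} (hG : IsBiPolyFun d G) (c : ℝ) :
    IsBiPolyFun d fun z => c * G z :=
  ⟨fun y => ((isPolyFun_const 0 c).mul (hG.fst y)).mono (by simp),
    fun x => ((isPolyFun_const 0 c).mul (hG.snd x)).mono (by simp),
    continuous_const.mul hG.continuous⟩

theorem isBiPolyFun_const (d : ℕ) (c : ℝ) : IsBiPolyFun d fun _ => c :=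
  ⟨fun _ => isPolyFun_const d c, fun _ => isPolyFun_const d c, continuous_const⟩

theorem isBiPolyFun_eval_fst (p : ℝ[X]) {d : ℕ} (hp : p.natDegree ≤ d) :
    IsBiPolyFun d fun z => p.eval z.1 :=
  ⟨fun _ => isPolyFun_eval p hp, fun x => isPolyFun_const d (p.eval x), p.continuous.comp continuous_fst⟩

theorem isBiPolyFun_eval_snd (p : ℝ[X]) {d : ℕ} (hp : p.natDegree ≤ d) :
    IsBiPolyFun d fun z => p.eval z.2 :=
  ⟨fun y => isPolyFun_const d (p.eval y), fun _ => isPolyFun_eval p hp, p.continuous.comp continuous_snd⟩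

theorem isBiPolyFun_det {j d : ℕ} {M : ℝ × ℝ → Matrix (Fin j) (Fin j) ℝ}
    (hM : ∀ a b, IsBiPolyFun d fun z => M z a b) : IsBiPolyFun (j * d) fun z => (M z).det :=
  ⟨fun y => isPolyFun_det fun a b => (hM a b).fst y, fun x => isPolyFun_det fun a b => (hM a b).snd x,
    Continuous.matrix_det (continuous_matrix fun a b => (hM a b).continuous)⟩

/-- A function that is a polynomial in each variable and is large somewhere on a rectangle is not
much smaller on most of it. -/
theorem exists_volume_prod_small_le (d : ℕ) {τ : ℝ} (hτ : 0 < τ) :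
    ∃ t : ℝ, 0 < t ∧ t ≤ 1 ∧ ∀ G : ℝ × ℝ → ℝ, IsBiPolyFun d G →
      ∀ u₁ w₁ u₂ w₂ c : ℝ, 0 < w₁ → 0 < w₂ → 0 < c →
      (∃ y ∈ Set.Ico u₁ (u₁ + w₁) ×ˢ Set.Ico u₂ (u₂ + w₂), c ≤ |G y|) →
      volume {x ∈ Set.Ico u₁ (u₁ + w₁) ×ˢ Set.Ico u₂ (u₂ + w₂) | |G x| < t * c} ≤
        ENNReal.ofReal τ * volume (Set.Ico u₁ (u₁ + w₁) ×ˢ Set.Ico u₂ (u₂ + w₂)) := by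
  obtain ⟨t, ht0, ht1, ht⟩ := exists_volume_small_le d (half_pos hτ)
  -- One factor t is lost on the line through y₂, outside a set A of abscissae, and another on each
  -- vertical line over the complement of A. Each costs τ/2 of the area.
  refine ⟨t * t, by positivity, mul_le_one₀ ht1 ht0.le ht1, ?_⟩
  rintro G hG u₁ w₁ u₂ w₂ c hw₁ hw₂ hc ⟨⟨y₁, y₂⟩, ⟨hy₁, hy₂⟩, hcy⟩
  simp only at hy₁ hy₂
  set I := Set.Ico u₁ (u₁ + w₁) with hI
  set J := Set.Ico u₂ (u₂ + w₂) with hJ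
  set A : Set ℝ := {x ∈ I | |G (x, y₂)| < t * c} with hA
  have hvolI : volume I = ENNReal.ofReal w₁ := by rw [hI, Real.volume_Ico]; ring_nf
  have hvolJ : volume J = ENNReal.ofReal w₂ := by rw [hJ, Real.volume_Ico]; ring_nf
  have hAvol : volume A ≤ ENNReal.ofReal (τ / 2 * w₁) := by
    obtain ⟨p, hp, h⟩ := hG.fst y₂
    simp only [hA, h]
    exact ht p hp u₁ w₁ c hw₁ hc ⟨y₁, hy₁, by rw [← h]; exact hcy⟩
  set E : Set (ℝ × ℝ) := {x | x ∈ (I \ A) ×ˢ J ∧ |G x| < t * t * c} with hE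
  have hGm : Measurable fun x => |G x| := hG.continuous.abs.measurable
  have hAm : MeasurableSet A := measurableSet_Ico.inter <| measurableSet_lt
    (hGm.comp (measurable_id.prodMk measurable_const)) measurable_const
  have hEm : MeasurableSet E := ((measurableSet_Ico.diff hAm).prod measurableSet_Ico).inter
    (measurableSet_lt hGm measurable_const)
  have hEvol : volume E ≤ ENNReal.ofReal (τ / 2 * w₂) * volume I := by
    rw [Measure.volume_eq_prod, Measure.prod_apply hEm, ← setLIntegral_const]
    rw [← lintegral_indicator measurableSet_Ico]
    refine lintegral_mono fun x => ?_
    by_cases hx : x ∈ I \ A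
    · rw [Set.indicator_of_mem hx.1]
      obtain ⟨p, hp, h⟩ := hG.snd x
      have hlarge : t * c ≤ |p.eval y₂| := by
        rw [← h]
        by_contra hlt
        exact hx.2 ⟨hx.1, not_le.1 hlt⟩
      refine le_trans (measure_mono ?_) (ht p hp u₂ w₂ (t * c) hw₂ (by positivity) ⟨y₂, hy₂, hlarge⟩)
      rintro y ⟨⟨-, hyJ⟩, hy⟩
      refine ⟨hyJ, ?_⟩
      rw [← h, ← mul_assoc]
      exact hy
    · have : Prod.mk x ⁻¹' E = ∅ := by
        ext y
        simp only [hE, Set.mem_preimage, Set.mem_empty_iff_false, iff_false]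
        rintro ⟨⟨h, -⟩, -⟩
        exact hx h
      rw [this]
      simp
  have hsub : {x ∈ I ×ˢ J | |G x| < t * t * c} ⊆ A ×ˢ J ∪ E := by
    rintro ⟨x, y⟩ ⟨⟨hx, hy⟩, hlt⟩
    by_cases hxA : x ∈ A
    · exact Or.inl ⟨hxA, hy⟩
    · exact Or.inr ⟨⟨⟨hx, hxA⟩, hy⟩, hlt⟩
  refine (measure_mono hsub).trans ((measure_union_le _ _).trans ?_)
  rw [Measure.volume_eq_prod, Measure.prod_prod, Measure.prod_prod, ← Measure.volume_eq_prod]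
  refine (add_le_add (mul_le_mul_left hAvol _) hEvol).trans ?_
  rw [hvolI, hvolJ, ← ENNReal.ofReal_mul (by positivity), ← ENNReal.ofReal_mul (by positivity),
    ← ENNReal.ofReal_add (by positivity) (by positivity), ← ENNReal.ofReal_mul (by positivity),
    ← ENNReal.ofReal_mul (by positivity)]
  apply ENNReal.ofReal_le_ofReal
  linarith

/-! ### Stopping argument on nested partitions. -/

/-- A refining sequence of countable measurable partitions, `cell k x` being the cell of
generation `k` containing `x`. -/
structure IsNestedPartition {X : Type*} [MeasurableSpace X] (cell : ℕ → X → Set X) : Prop where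
  mem : ∀ k x, x ∈ cell k x
  eq_of_mem : ∀ k x y, y ∈ cell k x → cell k y = cell k x
  succ_subset : ∀ k x, cell (k + 1) x ⊆ cell k x
  measurableSet : ∀ k x, MeasurableSet (cell k x)
  countable : ∀ k, (Set.range (cell k)).Countable

theorem IsNestedPartition.antitone {X : Type*} [MeasurableSpace X] {cell : ℕ → X → Set X}
    (hc : IsNestedPartition cell) (x : X) : Antitone fun k => cell k x :=
  antitone_nat_of_succ_le fun k => hc.succ_subset k x

/-- `s` is comparable with all members of `F` and is not one of them. -/
def IsCompatible {S : Type*} [PartialOrder S] (F : Finset S) (s : S) : Prop :=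
  s ∉ F ∧ ∀ u ∈ F, s ≤ u ∨ u ≤ s

/-- There is a chain `F` with `θ ≤ ψ s ≤ 1` for `s ∈ F` and `θ ≤ ψ s` for all `s` compatible
with `F`. -/
def IsMarked {S : Type*} [PartialOrder S] (ψ : S → ℝ) (θ : ℝ) : Prop :=
  ∃ F : Finset S, IsChain (· ≤ ·) (F : Set S) ∧ (∀ s ∈ F, θ ≤ ψ s ∧ ψ s ≤ 1) ∧
    ∀ s, IsCompatible F s → θ ≤ ψ s

/-- Induction on m, which bounds how much longer the chain F can grow. Stop at the first cell on
which some compatible s stays below t^|F|. Stopping cells are disjoint and cover the unmarked points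
under consideration. The parent did not stop, so every compatible function reaches t^|F| there,
hence t^(|F|+1) in the cell. Then s can join F: outside a proportion τ of the cell its function is
at least t^(|F|+2) ≥ t^(N+2), and the induction hypothesis handles the longer chain. -/
theorem measure_not_isMarked_inter_le {X S : Type*} [MeasurableSpace X] [PartialOrder S]
    (μ : Measure X) {cell : ℕ → X → Set X} (hc : IsNestedPartition cell) (ψ : S → X → ℝ)
    {t : ℝ} (ht0 : 0 < t) (ht1 : t ≤ 1) (τ : ENNReal) (N : ℕ)
    (hgood : ∀ s k x c, 0 < c → (∃ y ∈ cell k x, c ≤ ψ s y) →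
      μ {y ∈ cell k x | ψ s y < t * c} ≤ τ * μ (cell k x))
    (hdesc : ∀ s k x c, 0 < c → (∃ y ∈ cell k x, c ≤ ψ s y) →
      ∃ y ∈ cell (k + 1) x, t * c ≤ ψ s y)
    (hcont : ∀ s x c, ψ s x < c → ∃ k, ∀ y ∈ cell k x, ψ s y < c)
    (hchain : ∀ F : Finset S, IsChain (· ≤ ·) (F : Set S) → F.card ≤ N)
    (m : ℕ) : ∀ (F : Finset S) (k : ℕ) (x : X), N < F.card + m → IsChain (· ≤ ·) (F : Set S) →
      (∀ s ∈ F, ∀ y ∈ cell k x, ψ s y ≤ 1) →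
      (∀ s, IsCompatible F s → ∃ y ∈ cell k x, t ^ F.card ≤ ψ s y) →
      μ {y ∈ cell k x | ¬ IsMarked (fun s => ψ s y) (t ^ (N + 2)) ∧
        ∀ s ∈ F, t ^ (N + 2) ≤ ψ s y} ≤ m * τ * μ (cell k x) := by
  classical
  induction m with
  | zero =>
    intro F k x hm hF
    have := hchain F hF
    omega
  | succ m ih =>
    intro F k x hm hF hle hsup
    have hFN := hchain F hF
    set B := {y ∈ cell k x | ¬ IsMarked (fun s => ψ s y) (t ^ (N + 2)) ∧
        ∀ s ∈ F, t ^ (N + 2) ≤ ψ s y} with hB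
    let halts : X → ℕ → Prop := fun y l =>
      ∃ s, IsCompatible F s ∧ ∀ z ∈ cell (k + l) y, ψ s z < t ^ F.card
    have halts_congr : ∀ y z l, z ∈ cell (k + l) y → (halts z l ↔ halts y l) := by
      intro y z l hz
      simp only [halts, hc.eq_of_mem _ _ _ hz]
    let 𝒞 : Set (Set X) := {C | ∃ y l, y ∈ cell k x ∧ C = cell (k + l) y ∧ halts y l ∧
      ∀ l' < l, ¬ halts y l'}
    have sub𝒞 : ∀ C ∈ 𝒞, C ⊆ cell k x := by
      rintro C ⟨y, l, hy, rfl, -, -⟩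
      rw [← hc.eq_of_mem _ _ _ hy]
      exact hc.antitone y (Nat.le_add_right k l)
    have cnt𝒞 : 𝒞.Countable := by
      refine (Set.countable_iUnion fun l => hc.countable (k + l)).mono ?_
      rintro C ⟨y, l, -, rfl, -⟩
      exact Set.mem_iUnion.2 ⟨l, y, rfl⟩
    have meas𝒞 : ∀ C ∈ 𝒞, MeasurableSet C := by
      rintro C ⟨y, l, hy, rfl, -, -⟩
      exact hc.measurableSet _ _
    have disj𝒞 : 𝒞.PairwiseDisjoint id := by
      rintro C ⟨y, l, hy, rfl, hs, hmin⟩ C' ⟨y', l', hy', rfl, hs', hmin'⟩ hne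
      rw [Function.onFun, id, id, Set.disjoint_left]
      intro z hz hz'
      apply hne
      have key : ∀ (y : X) (l : ℕ), z ∈ cell (k + l) y → (∀ l' < l, ¬ halts y l') →
          ∀ l' < l, ¬ halts z l' := by
        intro y l hz hmin l' hl'
        rw [halts_congr y z l' (hc.antitone y (by omega : k + l' ≤ k + l) hz)]
        exact hmin l' hl'
      have h1 := key y l hz hmin
      have h2 := key y' l' hz' hmin'
      have h3 : halts z l := (halts_congr y z l hz).2 hs
      have h4 : halts z l' := (halts_congr y' z l' hz').2 hs'
      have : l = l' := by
        rcases lt_trichotomy l l' with h | h | h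
        · exact absurd h3 (h2 l h)
        · exact h
        · exact absurd h4 (h1 l' h)
      subst this
      rw [← hc.eq_of_mem _ _ _ hz, ← hc.eq_of_mem _ _ _ hz']
    have cover : B ⊆ ⋃ C ∈ 𝒞, B ∩ C := by
      intro y hy
      obtain ⟨hyx, hnm, hFy⟩ := hy
      -- Otherwise F itself marks y: by `hcont`, a compatible s below t^(N+2) at y stays below t^|F|
      -- on some small cell around y, and that cell halts.
      have hex : ∃ l, halts y l := by
        by_contra hno
        apply hnm
        refine ⟨F, hF, fun s hs => ⟨hFy s hs, hle s hs y hyx⟩, fun s hs => ?_⟩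
        by_contra hlt
        push Not at hlt
        have : ψ s y < t ^ F.card :=
          hlt.trans_le (pow_le_pow_of_le_one ht0.le ht1 (by omega))
        obtain ⟨k', hk'⟩ := hcont s y _ this
        exact hno ⟨k', s, hs, fun z hz => hk' z (hc.antitone y (Nat.le_add_left k' k) hz)⟩
      refine Set.mem_iUnion₂.2 ⟨cell (k + Nat.find hex) y, ⟨y, Nat.find hex, hyx, rfl,
        Nat.find_spec hex, fun l' hl' => Nat.find_min hex hl'⟩, ⟨⟨hyx, hnm, hFy⟩, hc.mem _ _⟩⟩
    have each : ∀ C ∈ 𝒞, μ (B ∩ C) ≤ (m + 1 : ℕ) * τ * μ C := by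
      rintro C ⟨y, l, hy, rfl, ⟨s, hs, hsC⟩, hmin⟩
      -- By `hsup` generation k never halts, so a stopping cell has a parent, and by minimality the
      -- parent does not halt.
      have hl : l ≠ 0 := by
        rintro rfl
        obtain ⟨z, hz, hz'⟩ := hsup s hs
        rw [← hc.eq_of_mem _ _ _ hy] at hz
        exact absurd hz' (not_le.2 (hsC z hz))
      obtain ⟨l, rfl⟩ := Nat.exists_eq_succ_of_ne_zero hl
      have hns := hmin l (Nat.lt_succ_self l)
      have hup : ∀ u, IsCompatible F u →
          ∃ z ∈ cell (k + (l + 1)) y, t ^ (F.card + 1) ≤ ψ u z := by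
        intro u hu
        have : ∃ z ∈ cell (k + l) y, t ^ F.card ≤ ψ u z := by
          by_contra hno
          push Not at hno
          exact hns ⟨u, hu, hno⟩
        obtain ⟨z, hz, hz'⟩ := hdesc u _ _ _ (pow_pos ht0 _) this
        exact ⟨z, hz, by rwa [pow_succ']⟩
      have hcard : (insert s F).card = F.card + 1 := Finset.card_insert_of_notMem hs.1
      have hF' : IsChain (· ≤ ·) ((insert s F : Finset S) : Set S) := by
        rw [Finset.coe_insert]
        exact hF.insert fun u hu _ => hs.2 u hu
      have h1 := ih (insert s F) (k + (l + 1)) y (by omega) hF'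
        (by
          intro u hu z hz
          rcases Finset.mem_insert.1 hu with rfl | hu
          · exact (hsC z hz).le.trans (pow_le_one₀ ht0.le ht1)
          · refine hle u hu z ?_
            rw [← hc.eq_of_mem _ _ _ hy]
            exact hc.antitone y (Nat.le_add_right k (l + 1)) hz)
        (by
          intro u hu
          rw [hcard]
          exact hup u ⟨fun h => hu.1 (Finset.mem_insert_of_mem h),
            fun w hw => hu.2 w (Finset.mem_insert_of_mem hw)⟩)
      have h2 := hgood s _ _ _ (pow_pos ht0 _) (hup s hs)
      calc μ (B ∩ cell (k + (l + 1)) y)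
          ≤ μ ({z ∈ cell (k + (l + 1)) y | ¬ IsMarked (fun s => ψ s z) (t ^ (N + 2)) ∧
              ∀ u ∈ insert s F, t ^ (N + 2) ≤ ψ u z} ∪
            {z ∈ cell (k + (l + 1)) y | ψ s z < t * t ^ (F.card + 1)}) := by
            apply measure_mono
            rintro z ⟨⟨-, hz1, hz2⟩, hzC⟩
            by_cases hlt : ψ s z < t * t ^ (F.card + 1)
            · exact Or.inr ⟨hzC, hlt⟩
            · refine Or.inl ⟨hzC, hz1, fun u hu => ?_⟩
              rcases Finset.mem_insert.1 hu with rfl | hu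
              · refine le_trans ?_ (not_lt.1 hlt)
                rw [← pow_succ']
                exact pow_le_pow_of_le_one ht0.le ht1 (by omega)
              · exact hz2 u hu
        _ ≤ m * τ * μ (cell (k + (l + 1)) y) + τ * μ (cell (k + (l + 1)) y) :=
            (measure_union_le _ _).trans (add_le_add h1 h2)
        _ = (m + 1 : ℕ) * τ * μ (cell (k + (l + 1)) y) := by
            push_cast
            ring
    calc μ B ≤ μ (⋃ C ∈ 𝒞, B ∩ C) := measure_mono cover
      _ ≤ ∑' C : 𝒞, μ (B ∩ C) := measure_biUnion_le μ cnt𝒞 _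
      _ ≤ ∑' C : 𝒞, (m + 1 : ℕ) * τ * μ C := ENNReal.tsum_le_tsum fun C => each C C.2
      _ = (m + 1 : ℕ) * τ * ∑' C : 𝒞, μ C := ENNReal.tsum_mul_left
      _ = (m + 1 : ℕ) * τ * μ (⋃ C ∈ 𝒞, C) := by
          have hsum := measure_biUnion (μ := μ) cnt𝒞 disj𝒞 meas𝒞
          simp only [id] at hsum
          rw [hsum]
      _ ≤ (m + 1 : ℕ) * τ * μ (cell k x) := by
          gcongr
          exact Set.iUnion₂_subset sub𝒞

theorem measure_not_isMarked_le {X S : Type*} [MeasurableSpace X] [PartialOrder S]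
    (μ : Measure X) {cell : ℕ → X → Set X} (hc : IsNestedPartition cell) (ψ : S → X → ℝ)
    {t : ℝ} (ht0 : 0 < t) (ht1 : t ≤ 1) (τ : ENNReal) (N : ℕ)
    (hgood : ∀ s k x c, 0 < c → (∃ y ∈ cell k x, c ≤ ψ s y) →
      μ {y ∈ cell k x | ψ s y < t * c} ≤ τ * μ (cell k x))
    (hdesc : ∀ s k x c, 0 < c → (∃ y ∈ cell k x, c ≤ ψ s y) →
      ∃ y ∈ cell (k + 1) x, t * c ≤ ψ s y)
    (hcont : ∀ s x c, ψ s x < c → ∃ k, ∀ y ∈ cell k x, ψ s y < c)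
    (hchain : ∀ F : Finset S, IsChain (· ≤ ·) (F : Set S) → F.card ≤ N) (x : X)
    (hsup : ∀ s, ∃ y ∈ cell 0 x, 1 ≤ ψ s y) :
    μ {y ∈ cell 0 x | ¬ IsMarked (fun s => ψ s y) (t ^ (N + 2))} ≤
      (N + 1 : ℕ) * τ * μ (cell 0 x) := by
  have := measure_not_isMarked_inter_le μ hc ψ ht0 ht1 τ N hgood hdesc hcont hchain (N + 1)
    ∅ 0 x (by simp) (by simp) (by simp) (fun s _ => by simpa using hsup s)
  simpa using this

/-! ### The dyadic subdivision of a rectangle. -/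

/-- The interval `[a + l i / 2 ^ k, a + l (i + 1) / 2 ^ k)` containing `u`. -/
noncomputable def dyadicIco (a l : ℝ) (k : ℕ) (u : ℝ) : Set ℝ :=
  Set.Ico (a + ⌊(u - a) / l * 2 ^ k⌋ * (l / 2 ^ k)) (a + ⌊(u - a) / l * 2 ^ k⌋ * (l / 2 ^ k) + l / 2 ^ k)

theorem mem_dyadicIco {a l : ℝ} (hl : 0 < l) {k : ℕ} {u y : ℝ} :
    y ∈ dyadicIco a l k u ↔ ⌊(y - a) / l * 2 ^ k⌋ = ⌊(u - a) / l * 2 ^ k⌋ := by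
  have hw : 0 < l / 2 ^ k := by positivity
  have h : (y - a) / l * 2 ^ k = (y - a) / (l / 2 ^ k) := by field_simp
  rw [Int.floor_eq_iff, h, le_div_iff₀ hw, div_lt_iff₀ hw, dyadicIco, Set.mem_Ico]
  constructor <;> rintro ⟨h1, h2⟩ <;> constructor <;> linarith

theorem dyadicIco_zero {a l : ℝ} (hl : 0 < l) {u : ℝ} (hu : u ∈ Set.Ico a (a + l)) :
    dyadicIco a l 0 u = Set.Ico a (a + l) := by
  have : ⌊(u - a) / l * 2 ^ 0⌋ = 0 := by
    rw [Int.floor_eq_zero_iff, pow_zero, mul_one, Set.mem_Ico, div_lt_one hl]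
    exact ⟨div_nonneg (by linarith [hu.1]) hl.le, by linarith [hu.2]⟩
  rw [dyadicIco, this]
  simp

theorem dyadicIco_eq_of_mem {a l : ℝ} (hl : 0 < l) {k : ℕ} {u y : ℝ} (h : y ∈ dyadicIco a l k u) :
    dyadicIco a l k y = dyadicIco a l k u := by
  rw [mem_dyadicIco hl] at h
  rw [dyadicIco, h, dyadicIco]

theorem mem_dyadicIco_self {a l : ℝ} (hl : 0 < l) (k : ℕ) (u : ℝ) : u ∈ dyadicIco a l k u :=
  (mem_dyadicIco hl).2 rfl

theorem dyadicIco_succ_subset {a l : ℝ} (hl : 0 < l) (k : ℕ) (u : ℝ) :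
    dyadicIco a l (k + 1) u ⊆ dyadicIco a l k u := by
  intro y hy
  rw [mem_dyadicIco hl] at hy ⊢
  have key : ∀ z : ℝ, ⌊(z - a) / l * 2 ^ k⌋ = ⌊(z - a) / l * 2 ^ (k + 1)⌋ / 2 := by
    intro z
    have := Int.floor_div_natCast ((z - a) / l * 2 ^ (k + 1)) 2
    rw [Nat.cast_ofNat, Nat.cast_ofNat] at this
    rw [← this]
    congr 1
    ring
  rw [key, key, hy]

theorem countable_range_dyadicIco (a l : ℝ) (k : ℕ) : (Set.range (dyadicIco a l k)).Countable := by
  refine (Set.countable_range fun i : ℤ =>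
    Set.Ico (a + i * (l / 2 ^ k)) (a + i * (l / 2 ^ k) + l / 2 ^ k)).mono ?_
  rintro _ ⟨u, rfl⟩
  exact ⟨_, rfl⟩

/-- The cell of generation `k` containing `x` in the dyadic subdivision of the plane generated by
the rectangle with corner `(a₁, a₂)` and sides `l₁`, `l₂`. -/
noncomputable def dyadicCell (a₁ a₂ l₁ l₂ : ℝ) (k : ℕ) (x : ℝ × ℝ) : Set (ℝ × ℝ) :=
  dyadicIco a₁ l₁ k x.1 ×ˢ dyadicIco a₂ l₂ k x.2

section DyadicCell

variable {a₁ a₂ l₁ l₂ : ℝ}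

theorem isNestedPartition_dyadicCell (hl₁ : 0 < l₁) (hl₂ : 0 < l₂) :
    IsNestedPartition (dyadicCell a₁ a₂ l₁ l₂) where
  mem k x := ⟨mem_dyadicIco_self hl₁ k x.1, mem_dyadicIco_self hl₂ k x.2⟩
  eq_of_mem k x y h := by
    rw [dyadicCell, dyadicIco_eq_of_mem hl₁ h.1, dyadicIco_eq_of_mem hl₂ h.2, dyadicCell]
  succ_subset k x := Set.prod_mono (dyadicIco_succ_subset hl₁ k _) (dyadicIco_succ_subset hl₂ k _)
  measurableSet k x := measurableSet_Ico.prod measurableSet_Ico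
  countable k := by
    refine (((countable_range_dyadicIco a₁ l₁ k).prod (countable_range_dyadicIco a₂ l₂ k)).image
      fun s => s.1 ×ˢ s.2).mono ?_
    rintro _ ⟨x, rfl⟩
    exact ⟨(_, _), ⟨⟨x.1, rfl⟩, ⟨x.2, rfl⟩⟩, rfl⟩

theorem volume_dyadicCell (hl₁ : 0 < l₁) (k : ℕ) (x : ℝ × ℝ) :
    volume (dyadicCell a₁ a₂ l₁ l₂ k x) = ENNReal.ofReal (l₁ * l₂ / 4 ^ k) := by
  rw [dyadicCell, Measure.volume_eq_prod, Measure.prod_prod, dyadicIco, dyadicIco, Real.volume_Ico,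
    Real.volume_Ico, add_sub_cancel_left, add_sub_cancel_left, ← ENNReal.ofReal_mul (by positivity)]
  congr 1
  rw [show (4 : ℝ) = 2 * 2 by norm_num, mul_pow]
  field_simp

theorem exists_dyadicCell_subset (hl₁ : 0 < l₁) (hl₂ : 0 < l₂) {ψ : ℝ × ℝ → ℝ} (hψ : Continuous ψ)
    {x : ℝ × ℝ} {c : ℝ} (hx : ψ x < c) : ∃ k, ∀ y ∈ dyadicCell a₁ a₂ l₁ l₂ k x, ψ y < c := by
  have hnhds : {y | ψ y < c} ∈ nhds x := (isOpen_lt hψ continuous_const).mem_nhds hx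
  obtain ⟨r, hr, hball⟩ := Metric.mem_nhds_iff.1 hnhds
  obtain ⟨k, hk⟩ := exists_pow_lt_of_lt_one (show 0 < r / max l₁ l₂ by positivity)
    (show (1 / 2 : ℝ) < 1 by norm_num)
  have hk' : max l₁ l₂ / 2 ^ k < r := by
    rw [lt_div_iff₀ (by positivity), one_div, inv_pow, inv_mul_eq_div] at hk
    exact hk
  have key : ∀ a l u y : ℝ, 0 < l → l ≤ max l₁ l₂ → y ∈ dyadicIco a l k u → |y - u| < r := by
    intro a l u y hl hle hy
    have hu := mem_dyadicIco_self (a := a) hl k u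
    have h1 : |y - u| < l / 2 ^ k := by
      rw [abs_lt]
      constructor <;> linarith [hy.1, hy.2, hu.1, hu.2]
    have h2 : l / 2 ^ k ≤ max l₁ l₂ / 2 ^ k := by gcongr
    linarith
  refine ⟨k, fun y hy => hball ?_⟩
  rw [Metric.mem_ball, Prod.dist_eq, max_lt_iff, Real.dist_eq, Real.dist_eq]
  exact ⟨key _ _ _ _ hl₁ (le_max_left _ _) hy.1, key _ _ _ _ hl₂ (le_max_right _ _) hy.2⟩

/-- A child has a quarter of the area of its parent, too much to lie inside an exceptional set of
proportion τ < 1/4. -/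
theorem exists_mem_dyadicCell_succ (hl₁ : 0 < l₁) (hl₂ : 0 < l₂) {ψ : ℝ × ℝ → ℝ} {τ t c : ℝ}
    (hτ : τ < 1 / 4) {k : ℕ} {x : ℝ × ℝ}
    (h : volume {y ∈ dyadicCell a₁ a₂ l₁ l₂ k x | ψ y < t * c} ≤
      ENNReal.ofReal τ * volume (dyadicCell a₁ a₂ l₁ l₂ k x)) :
    ∃ y ∈ dyadicCell a₁ a₂ l₁ l₂ (k + 1) x, t * c ≤ ψ y := by
  by_contra hno
  push Not at hno
  have hsub : dyadicCell a₁ a₂ l₁ l₂ (k + 1) x ⊆ {y ∈ dyadicCell a₁ a₂ l₁ l₂ k x | ψ y < t * c} :=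
    fun y hy => ⟨(isNestedPartition_dyadicCell hl₁ hl₂).succ_subset k x hy, hno y hy⟩
  have h1 := (measure_mono (μ := volume) hsub).trans h
  rw [volume_dyadicCell hl₁, volume_dyadicCell hl₁] at h1
  have hpos : 0 < l₁ * l₂ / 4 ^ k := by positivity
  rw [← ENNReal.ofReal_mul' hpos.le, pow_succ, ← div_div] at h1
  have h2 := (ENNReal.ofReal_le_ofReal_iff' ).1 h1
  rcases h2 with h2 | h2
  · nlinarith
  · linarith

end DyadicCell

/-! ### Families of integer polynomials, their minors and echelon bases. -/

/-- `p` is an integer polynomial of degree at most `n`, seen as a real one. -/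
def IsIntPoly (n : ℕ) (p : ℝ[X]) : Prop :=
  ∃ P : ℤ[X], P.natDegree ≤ n ∧ P.map (Int.castRingHom ℝ) = p

theorem IsIntPoly.natDegree_le {n : ℕ} {p : ℝ[X]} (hp : IsIntPoly n p) : p.natDegree ≤ n := by
  obtain ⟨P, hP, rfl⟩ := hp
  exact natDegree_map_le.trans hP

theorem IsIntPoly.exists_coeff {n : ℕ} {p : ℝ[X]} (hp : IsIntPoly n p) (i : ℕ) :
    ∃ z : ℤ, p.coeff i = z := by
  obtain ⟨P, -, rfl⟩ := hp
  exact ⟨P.coeff i, by simp⟩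

/-- A linearly independent family of integer polynomials of degree at most `n`. -/
structure IsIntFamily (n : ℕ) {j : ℕ} (A : Fin j → ℝ[X]) : Prop where
  isIntPoly : ∀ a, IsIntPoly n (A a)
  linearIndependent : LinearIndependent ℝ A

/-- The determinant of the values of the functionals `L (f b)` at the members of `A`. -/
noncomputable def minor {ι : Type*} (L : ι → ℝ[X] →ₗ[ℝ] ℝ) {j : ℕ} (A : Fin j → ℝ[X])
    (f : Fin j → ι) : ℝ :=
  (Matrix.of fun a b => L (f b) (A a)).det

/-- The largest absolute value of a minor. -/
noncomputable def minorNorm {ι : Type*} [Fintype ι] (L : ι → ℝ[X] →ₗ[ℝ] ℝ) {j : ℕ}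
    (A : Fin j → ℝ[X]) : ℝ :=
  ‖fun f : Fin j → ι => minor L A f‖

theorem abs_minor_le_minorNorm {ι : Type*} [Fintype ι] (L : ι → ℝ[X] →ₗ[ℝ] ℝ) {j : ℕ}
    (A : Fin j → ℝ[X]) (f : Fin j → ι) : |minor L A f| ≤ minorNorm L A :=
  norm_le_pi_norm (fun f : Fin j → ι => minor L A f) f

theorem minorNorm_nonneg {ι : Type*} [Fintype ι] (L : ι → ℝ[X] →ₗ[ℝ] ℝ) {j : ℕ}
    (A : Fin j → ℝ[X]) : 0 ≤ minorNorm L A :=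
  norm_nonneg _

theorem minorNorm_zero {ι : Type*} [Fintype ι] (L : ι → ℝ[X] →ₗ[ℝ] ℝ) (A : Fin 0 → ℝ[X]) :
    minorNorm L A = 1 := by
  have : (fun f : Fin 0 → ι => minor L A f) = fun _ => 1 := by
    funext f
    simp [minor]
  rw [minorNorm, this, Pi.norm_def]
  simp

/-- A change of basis multiplies all minors by one number that does not depend on L, so bases of the
same span can be compared for all L at once. -/
theorem minor_eq_det_mul {ι : Type*} (L : ι → ℝ[X] →ₗ[ℝ] ℝ) {j : ℕ} {A R : Fin j → ℝ[X]}
    {M : Matrix (Fin j) (Fin j) ℝ} (h : ∀ a, A a = ∑ b, M a b • R b) (f : Fin j → ι) :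
    minor L A f = M.det * minor L R f := by
  rw [minor, minor, ← Matrix.det_mul]
  congr 1
  ext a b
  simp [Matrix.mul_apply, h a]

theorem minorNorm_eq_abs_det_mul {ι : Type*} [Fintype ι] (L : ι → ℝ[X] →ₗ[ℝ] ℝ) {j : ℕ}
    {A R : Fin j → ℝ[X]} {M : Matrix (Fin j) (Fin j) ℝ} (h : ∀ a, A a = ∑ b, M a b • R b) :
    minorNorm L A = |M.det| * minorNorm L R := by
  have : (fun f : Fin j → ι => minor L A f) = M.det • fun f : Fin j → ι => minor L R f := by
    funext f
    simp [minor_eq_det_mul L h]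
  rw [minorNorm, minorNorm, this, norm_smul, Real.norm_eq_abs]

/-- Laplace expansion along the row of v: the cofactors are minors of A. A short v thus makes the
enlarged family small. -/
theorem minorNorm_cons_le {ι : Type*} [Fintype ι] (L : ι → ℝ[X] →ₗ[ℝ] ℝ) {j : ℕ}
    (A : Fin j → ℝ[X]) (v : ℝ[X]) {C : ℝ} (hC0 : 0 ≤ C) (hC : ∀ c, |L c v| ≤ C) :
    minorNorm L (Fin.cons v A : Fin (j + 1) → ℝ[X]) ≤ (j + 1) * C * minorNorm L A := by
  have h0 := minorNorm_nonneg L A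
  refine (pi_norm_le_iff_of_nonneg (by positivity)).2 fun f => ?_
  rw [Real.norm_eq_abs, minor, Matrix.det_succ_row_zero]
  refine (Finset.abs_sum_le_sum_abs _ _).trans ?_
  refine (Finset.sum_le_card_nsmul _ _ (C * minorNorm L A) fun b _ => ?_).trans (le_of_eq ?_)
  · refine le_trans (le_of_eq ?_) (mul_le_mul (hC (f b))
      (abs_minor_le_minorNorm L A (f ∘ b.succAbove)) (abs_nonneg _) hC0)
    rw [abs_mul, abs_mul, abs_pow, abs_neg, abs_one, one_pow, one_mul]
    rfl
  simp
  ring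

/-- The polynomials `R` are monic and their degrees increase strictly. -/
structure IsEchelon {j : ℕ} (R : Fin j → ℝ[X]) : Prop where
  monic : ∀ i, (R i).Monic
  strictMono : StrictMono fun i => (R i).natDegree

/-- The coefficient matrix is triangular with unit diagonal. This normalisation makes transition
determinants readable from coefficients. -/
theorem IsEchelon.minor_coeff {j : ℕ} {R : Fin j → ℝ[X]} (hR : IsEchelon R) :
    minor (fun i : ℕ => lcoeff ℝ i) R (fun b => (R b).natDegree) = 1 := by
  rw [minor, Matrix.det_of_isLowerTriangular]
  · simp [fun i => (hR.monic i).coeff_natDegree]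
  · intro a b hab
    exact coeff_eq_zero_of_natDegree_lt (hR.strictMono hab)

theorem exists_isEchelon (W : Submodule ℝ ℝ[X]) {n : ℕ} (hW : ∀ p ∈ W, p.natDegree ≤ n) :
    ∃ (k : ℕ) (R : Fin k → ℝ[X]), IsEchelon R ∧ LinearIndependent ℝ R ∧
      Submodule.span ℝ (Set.range R) = W := by
  classical
  -- Degrees that do not occur in W are filled with X^i, so that T has one monic member in each
  -- degree and is independent at once. Elimination of leading terms then shows that the members in
  -- W span W.
  have hS : ∀ i : ℕ, ∃ p : ℝ[X], p.Monic ∧ p.natDegree = i ∧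
      ((∃ q ∈ W, q ≠ 0 ∧ q.natDegree = i) → p ∈ W) := by
    intro i
    by_cases h : ∃ q ∈ W, q ≠ 0 ∧ q.natDegree = i
    · obtain ⟨q, hq, hq0, hqi⟩ := h
      have hlc : q.leadingCoeff ≠ 0 := leadingCoeff_ne_zero.2 hq0
      refine ⟨q.leadingCoeff⁻¹ • q, ?_, ?_, fun _ => W.smul_mem _ hq⟩
      · rw [Monic, smul_eq_C_mul, leadingCoeff_mul, leadingCoeff_C, inv_mul_cancel₀ hlc]
      · rw [natDegree_smul _ (inv_ne_zero hlc), hqi]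
    · exact ⟨X ^ i, monic_X_pow i, natDegree_X_pow i, fun h' => absurd h' h⟩
  choose T hTm hTd hTW using hS
  let T' : Polynomial.Sequence ℝ :=
    ⟨T, fun i => by rw [degree_eq_natDegree (hTm i).ne_zero, hTd i]⟩
  have hTli : LinearIndependent ℝ T := T'.linearIndependent
  let D := (Finset.range (n + 1)).filter fun i => ∃ q ∈ W, q ≠ 0 ∧ q.natDegree = i
  let e := D.orderEmbOfFin rfl
  have heW : ∀ i, T (e i) ∈ W := fun i =>
    hTW _ (Finset.mem_filter.1 (D.orderEmbOfFin_mem rfl i)).2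
  refine ⟨D.card, fun i => T (e i), ⟨fun i => hTm _, fun i i' h => ?_⟩,
    hTli.comp _ e.injective, le_antisymm ?_ ?_⟩
  · simpa [hTd] using h
  · rw [Submodule.span_le]
    rintro _ ⟨i, rfl⟩
    exact heW i
  · have key : ∀ m : ℕ, ∀ p ∈ W, p.natDegree < m →
        p ∈ Submodule.span ℝ (Set.range fun i => T (e i)) := by
      intro m
      induction m with
      | zero => exact fun p _ h => absurd h (Nat.not_lt_zero _)
      | succ m ih =>
        intro p hp hpm
        by_cases hp0 : p = 0
        · rw [hp0]
          exact Submodule.zero_mem _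
        have hD : p.natDegree ∈ D :=
          Finset.mem_filter.2 ⟨Finset.mem_range.2 (Nat.lt_succ_of_le (hW p hp)), p, hp, hp0, rfl⟩
        obtain ⟨i, hi⟩ : ∃ i, e i = p.natDegree := by
          have : p.natDegree ∈ Set.range e := by
            rw [Finset.range_orderEmbOfFin]
            exact hD
          exact this
        have hTi : T (e i) ∈ Submodule.span ℝ (Set.range fun i => T (e i)) :=
          Submodule.subset_span ⟨i, rfl⟩
        set q := p - p.leadingCoeff • T (e i) with hq
        have hpq : p = q + p.leadingCoeff • T (e i) := by rw [hq, sub_add_cancel]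
        have hqW : q ∈ W := W.sub_mem hp (W.smul_mem _ (heW i))
        have hqspan : q ∈ Submodule.span ℝ (Set.range fun i => T (e i)) := by
          by_cases hq0 : q = 0
          · rw [hq0]
            exact Submodule.zero_mem _
          refine ih q hqW ?_
          have hlc : p.leadingCoeff ≠ 0 := leadingCoeff_ne_zero.2 hp0
          have hdeg : q.degree < p.degree := by
            apply degree_sub_lt_left _ hp0
            · rw [smul_eq_C_mul, leadingCoeff_mul, leadingCoeff_C, (hTm _).leadingCoeff, mul_one]
            · rw [degree_smul_of_smul_regular _ (IsSMulRegular.of_ne_zero hlc),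
                degree_eq_natDegree (hTm _).ne_zero, hTd, hi, degree_eq_natDegree hp0]
          have := natDegree_lt_natDegree hq0 hdeg
          omega
        rw [hpq]
        exact Submodule.add_mem _ hqspan (Submodule.smul_mem _ _ hTi)
    exact fun p hp => key _ p hp (Nat.lt_succ_self _)

theorem IsIntFamily.natDegree_le_of_mem_span {n j : ℕ} {A : Fin j → ℝ[X]} (hA : IsIntFamily n A)
    {p : ℝ[X]} (hp : p ∈ Submodule.span ℝ (Set.range A)) : p.natDegree ≤ n := by
  have h : Submodule.span ℝ (Set.range A) ≤ degreeLE ℝ n := by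
    rw [Submodule.span_le]
    rintro _ ⟨a, rfl⟩
    exact mem_degreeLE.2 (natDegree_le_iff_degree_le.1 (hA.isIntPoly a).natDegree_le)
  exact natDegree_le_iff_degree_le.2 (mem_degreeLE.1 (h hp))

theorem LinearIndependent.eq_of_span_eq {j k : ℕ} {A : Fin j → ℝ[X]} {B : Fin k → ℝ[X]}
    (hA : LinearIndependent ℝ A) (hB : LinearIndependent ℝ B)
    (h : Submodule.span ℝ (Set.range A) = Submodule.span ℝ (Set.range B)) : j = k := by
  have h1 := finrank_span_eq_card hA
  have h2 := finrank_span_eq_card hB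
  rw [h] at h1
  simpa using h1.symm.trans h2

theorem IsIntFamily.exists_isEchelon {n j : ℕ} {A : Fin j → ℝ[X]} (hA : IsIntFamily n A) :
    ∃ R : Fin j → ℝ[X], IsEchelon R ∧
      Submodule.span ℝ (Set.range R) = Submodule.span ℝ (Set.range A) ∧
      ∀ i, (R i).natDegree ≤ n := by
  obtain ⟨k, R, hR, hRli, hspan⟩ := _root_.exists_isEchelon (Submodule.span ℝ (Set.range A))
    (fun p hp => hA.natDegree_le_of_mem_span hp)
  obtain rfl := hA.linearIndependent.eq_of_span_eq hRli hspan.symm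
  exact ⟨R, hR, hspan, fun i => hA.natDegree_le_of_mem_span
    (hspan ▸ Submodule.subset_span ⟨i, rfl⟩)⟩

/-- Taking coefficients at the degrees of R turns the minor of R into 1, so det M equals a minor of
integer coefficients of A. It is nonzero because A is independent. -/
theorem IsIntFamily.exists_det {n j : ℕ} {A R : Fin j → ℝ[X]} (hA : IsIntFamily n A)
    (hR : IsEchelon R) (hspan : Submodule.span ℝ (Set.range A) = Submodule.span ℝ (Set.range R)) :
    ∃ z : ℤ, z ≠ 0 ∧ ∃ M : Matrix (Fin j) (Fin j) ℝ, M.det = z ∧ ∀ a, A a = ∑ b, M a b • R b := by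
  have hM : ∀ a, ∃ c : Fin j → ℝ, ∑ b, c b • R b = A a := fun a =>
    (Submodule.mem_span_range_iff_exists_fun ℝ).1 (hspan ▸ Submodule.subset_span ⟨a, rfl⟩)
  choose M hM using hM
  have hint : ∀ a i, ∃ z : ℤ, (A a).coeff i = z := fun a i => (hA.isIntPoly a).exists_coeff i
  choose Z hZ using hint
  have hdet : Matrix.det (Matrix.of M) =
      ((Matrix.of fun a b => Z a (R b).natDegree).det : ℤ) := by
    have h := minor_eq_det_mul (fun i : ℕ => lcoeff ℝ i) (M := Matrix.of M)
      (fun a => (hM a).symm) (fun b => (R b).natDegree)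
    rw [hR.minor_coeff, mul_one] at h
    rw [← h, minor, Int.cast_det]
    congr 1
    ext a b
    simp [hZ]
  have hne : Matrix.det (Matrix.of M) ≠ 0 := by
    intro h0
    obtain ⟨v, hv, hv0⟩ := Matrix.exists_vecMul_eq_zero_iff.2 h0
    apply hv
    have hsum : ∑ a, v a • A a = 0 := by
      calc ∑ a, v a • A a = ∑ a, ∑ b, (v a * M a b) • R b := by
            simp only [← hM, Finset.smul_sum, smul_smul]
        _ = ∑ b, (Matrix.vecMul v (Matrix.of M)) b • R b := by
            rw [Finset.sum_comm]
            simp [Matrix.vecMul, dotProduct, Finset.sum_smul]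
        _ = 0 := by simp [hv0]
    funext a
    exact Fintype.linearIndependent_iff.1 hA.linearIndependent v hsum a
  exact ⟨_, fun h0 => hne (by rw [hdet, h0, Int.cast_zero]), Matrix.of M, hdet,
    fun a => (hM a).symm⟩

theorem IsIntFamily.card_le {n j : ℕ} {A : Fin j → ℝ[X]} (hA : IsIntFamily n A) : j ≤ n + 1 := by
  obtain ⟨R, hR, -, hdeg⟩ := hA.exists_isEchelon
  have := Fintype.card_le_of_injective
    (fun i : Fin j => (⟨(R i).natDegree, Nat.lt_succ_of_le (hdeg i)⟩ : Fin (n + 1)))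
    (fun i i' h => hR.strictMono.injective (by simpa using h))
  simpa using this

/-- Among the integer families with a given span there is one with the smallest minors. -/
theorem IsIntFamily.exists_primitive (ι : Type*) [Fintype ι] {n j : ℕ} {A : Fin j → ℝ[X]}
    (hA : IsIntFamily n A) : ∃ B : Fin j → ℝ[X], IsIntFamily n B ∧
      Submodule.span ℝ (Set.range B) = Submodule.span ℝ (Set.range A) ∧
      ∀ (k : ℕ) (C : Fin k → ℝ[X]), IsIntFamily n C →
        Submodule.span ℝ (Set.range C) = Submodule.span ℝ (Set.range A) →
        ∀ L : ι → ℝ[X] →ₗ[ℝ] ℝ, minorNorm L B ≤ minorNorm L C := by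
  obtain ⟨R, hR, hspan, -⟩ := hA.exists_isEchelon
  -- The minors of every integer basis are a natural number times those of the fixed echelon basis
  -- R. Minimising that number gives one basis that is optimal for every L, hence at every point of
  -- the plane.
  let s : Set ℕ := {m | ∃ B : Fin j → ℝ[X], IsIntFamily n B ∧
    Submodule.span ℝ (Set.range B) = Submodule.span ℝ (Set.range A) ∧
    ∀ L : ι → ℝ[X] →ₗ[ℝ] ℝ, minorNorm L B = m * minorNorm L R}
  have hs : ∀ B : Fin j → ℝ[X], IsIntFamily n B →
      Submodule.span ℝ (Set.range B) = Submodule.span ℝ (Set.range A) → ∃ m ∈ s,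
      ∀ L : ι → ℝ[X] →ₗ[ℝ] ℝ, minorNorm L B = m * minorNorm L R := by
    intro B hB hBA
    obtain ⟨z, -, M, hM, h⟩ := hB.exists_det hR (hBA.trans hspan.symm)
    have : ∀ L : ι → ℝ[X] →ₗ[ℝ] ℝ, minorNorm L B = (z.natAbs : ℕ) * minorNorm L R := by
      intro L
      rw [minorNorm_eq_abs_det_mul L h, hM, Nat.cast_natAbs, Int.cast_abs]
    exact ⟨z.natAbs, ⟨B, hB, hBA, this⟩, this⟩
  have hne : s.Nonempty := by
    obtain ⟨m, hm, -⟩ := hs A hA rfl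
    exact ⟨m, hm⟩
  obtain ⟨B, hB, hBA, hBL⟩ := Nat.sInf_mem hne
  refine ⟨B, hB, hBA, fun k C hC hCA L => ?_⟩
  obtain rfl := hA.linearIndependent.eq_of_span_eq hC.linearIndependent hCA.symm
  obtain ⟨m, hm, hmL⟩ := hs C hC hCA
  rw [hBL, hmL]
  have h0 := minorNorm_nonneg L R
  gcongr
  exact Nat.sInf_le hm

theorem IsIntFamily.cons {n j : ℕ} {A : Fin j → ℝ[X]} (hA : IsIntFamily n A) {v : ℝ[X]}
    (hv : IsIntPoly n v) (hvA : v ∉ Submodule.span ℝ (Set.range A)) :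
    IsIntFamily n (Fin.cons v A : Fin (j + 1) → ℝ[X]) :=
  ⟨fun a => by
    refine Fin.cases ?_ (fun i => ?_) a
    · simpa using hv
    · simpa using hA.isIntPoly i,
    linearIndependent_finCons.2 ⟨hA.linearIndependent, hvA⟩⟩

/-! ### Rational subspaces and the nondivergence estimate. -/

/-- The subspaces of `ℝ[X]` spanned by integer polynomials of degree at most `n`. -/
abbrev IntSubspace (n : ℕ) : Type :=
  {W : Submodule ℝ ℝ[X] // ∃ (j : ℕ) (A : Fin j → ℝ[X]), IsIntFamily n A ∧
    Submodule.span ℝ (Set.range A) = W}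

/-- On a chain the dimension is injective, with values 0, ..., n + 1. -/
theorem card_le_of_isChain {n : ℕ} (F : Finset (IntSubspace n))
    (hF : IsChain (· ≤ ·) (F : Set (IntSubspace n))) : F.card ≤ n + 2 := by
  have hfin : ∀ W : IntSubspace n, Module.finrank ℝ W.1 ≤ n + 1 ∧ Module.Finite ℝ W.1 := by
    rintro ⟨_, j, A, hA, rfl⟩
    refine ⟨?_, Module.Finite.span_of_finite ℝ (Set.finite_range A)⟩
    rw [finrank_span_eq_card hA.linearIndependent, Fintype.card_fin]
    exact hA.card_le
  have := Finset.card_le_card_of_injOn (s := F) (t := Finset.range (n + 2))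
    (fun W => Module.finrank ℝ W.1)
    (fun W _ => Finset.mem_coe.2 (Finset.mem_range.2 (Nat.lt_succ_of_le (hfin W).1)))
    (by
      intro W hW W' hW' h
      have := (hfin W).2
      have := (hfin W').2
      rcases hF.total hW hW' with hle | hle
      · exact Subtype.ext (Submodule.eq_of_le_of_finrank_eq hle h)
      · exact (Subtype.ext (Submodule.eq_of_le_of_finrank_eq hle h.symm)).symm)
  simpa using this

/-- Take the largest W in F that does not contain v, or the zero space, of norm 1, if there is none.
Larger members of F contain v, so W + ℝv is comparable with all of F. Whether it is in F or
compatible with F, its norm is at least θ, while expansion along v bounds it by (n+1)C times the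
norm of W, which is at most 1. -/
theorem le_minorNorm_of_isMarked {ι : Type*} [Fintype ι] {n : ℕ} (L : ι → ℝ[X] →ₗ[ℝ] ℝ)
    (ψ : IntSubspace n → ℝ) {θ : ℝ}
    (hle : ∀ (W : IntSubspace n) (j : ℕ) (A : Fin j → ℝ[X]), IsIntFamily n A →
      Submodule.span ℝ (Set.range A) = W.1 → ψ W ≤ minorNorm L A)
    (hex : ∀ W : IntSubspace n, ∃ (j : ℕ) (A : Fin j → ℝ[X]), IsIntFamily n A ∧
      Submodule.span ℝ (Set.range A) = W.1 ∧ ψ W = minorNorm L A)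
    (hm : IsMarked ψ θ) {v : ℝ[X]} (hv : IsIntPoly n v) (hv0 : v ≠ 0) {C : ℝ} (hC0 : 0 ≤ C)
    (hC : ∀ c, |L c v| ≤ C) : θ ≤ (n + 1) * C := by
  classical
  obtain ⟨F, hF, hFψ, hcomp⟩ := hm
  obtain ⟨j, A, hA, hvA, hA1, hFA⟩ : ∃ (j : ℕ) (A : Fin j → ℝ[X]), IsIntFamily n A ∧
      v ∉ Submodule.span ℝ (Set.range A) ∧ minorNorm L A ≤ 1 ∧
      ∀ u ∈ F, u.1 ≤ Submodule.span ℝ (Set.range A) ∨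
        v ∈ u.1 ∧ Submodule.span ℝ (Set.range A) ≤ u.1 := by
    by_cases hne : (F.filter fun W => v ∉ W.1).Nonempty
    · obtain ⟨W, hW, hmax⟩ := Finset.exists_maximal hne
      obtain ⟨hWF, hvW⟩ := Finset.mem_filter.1 hW
      obtain ⟨j, A, hA, hspan, hψ⟩ := hex W
      refine ⟨j, A, hA, by rwa [hspan], hψ ▸ (hFψ W hWF).2, fun u hu => ?_⟩
      rw [hspan]
      by_cases hvu : v ∈ u.1
      · rcases hF.total hu hWF with h | h
        · exact Or.inl h
        · exact Or.inr ⟨hvu, h⟩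
      · rcases hF.total hu hWF with h | h
        · exact Or.inl h
        · exact Or.inl (hmax (Finset.mem_filter.2 ⟨hu, hvu⟩) h)
    · rw [Finset.not_nonempty_iff_eq_empty] at hne
      refine ⟨0, Fin.elim0, ⟨fun a => a.elim0, linearIndependent_empty_type⟩, by simpa using hv0,
        (minorNorm_zero L _).le, fun u hu => Or.inr ⟨?_, by simp⟩⟩
      by_contra hvu
      have : u ∈ F.filter fun W => v ∉ W.1 := Finset.mem_filter.2 ⟨hu, hvu⟩
      simp [hne] at this
  have hB := hA.cons hv hvA
  let W : IntSubspace n := ⟨Submodule.span ℝ (Set.range (Fin.cons v A : Fin (j + 1) → ℝ[X])),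
    _, _, hB, rfl⟩
  have hθW : θ ≤ ψ W := by
    by_cases hWF : W ∈ F
    · exact (hFψ W hWF).1
    · refine hcomp W ⟨hWF, fun u hu => ?_⟩
      have hspan : W.1 = Submodule.span ℝ (insert v (Set.range A)) := by
        simp only [W, Fin.range_cons]
      rcases hFA u hu with h | ⟨hvu, h⟩
      · right
        change u.1 ≤ W.1
        refine le_trans h ?_
        rw [hspan]
        exact Submodule.span_mono (Set.subset_insert _ _)
      · left
        change W.1 ≤ u.1
        rw [hspan, Submodule.span_le, Set.insert_subset_iff]
        exact ⟨hvu, Submodule.span_le.1 h⟩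
  have hj : ((j + 1 : ℕ) : ℝ) ≤ ((n + 1 : ℕ) : ℝ) := Nat.cast_le.2 hB.card_le
  push_cast at hj
  have h0 := minorNorm_nonneg L A
  calc θ ≤ minorNorm L (Fin.cons v A : Fin (j + 1) → ℝ[X]) := hθW.trans (hle W _ _ hB rfl)
    _ ≤ (j + 1) * C * minorNorm L A := minorNorm_cons_le L A v hC0 hC
    _ ≤ (n + 1) * C * 1 := by gcongr
    _ = _ := mul_one _

/-- Quantitative nondivergence: if the minors of all integer families are large somewhere on a
rectangle, then at most points of the rectangle no nonzero integer polynomial is small. -/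
theorem exists_volume_short_le (ι : Type*) [Fintype ι] (n d : ℕ) {τ : ℝ} (hτ : 0 < τ) :
    ∃ σ : ℝ, 0 < σ ∧ ∀ a₁ a₂ l₁ l₂ : ℝ, 0 < l₁ → 0 < l₂ →
      ∀ L : ι → ℝ × ℝ → ℝ[X] →ₗ[ℝ] ℝ,
      (∀ c p, p.natDegree ≤ n → IsBiPolyFun d fun z => L c z p) →
      (∀ (j : ℕ) (A : Fin j → ℝ[X]), IsIntFamily n A →
        ∃ y ∈ Set.Ico a₁ (a₁ + l₁) ×ˢ Set.Ico a₂ (a₂ + l₂), 1 ≤ minorNorm (fun c => L c y) A) →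
      volume {x ∈ Set.Ico a₁ (a₁ + l₁) ×ˢ Set.Ico a₂ (a₂ + l₂) |
        ∃ p, IsIntPoly n p ∧ p ≠ 0 ∧ ∀ c, |L c x p| < σ} ≤ ENNReal.ofReal (τ * (l₁ * l₂)) := by
  -- The bound 1/8 < 1/4 serves the passage from a cell to its child. With N = n + 2 the stopping
  -- argument loses N + 1 = n + 3 times τ'.
  set τ' : ℝ := min (1 / 8) (τ / (n + 3)) with hτ'
  have hτ'0 : 0 < τ' := by positivity
  obtain ⟨t, ht0, ht1, ht⟩ := exists_volume_prod_small_le ((n + 1) * d) hτ'0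
  -- The marking level is t^(N+2) = t^(n+4); dividing by n + 2 rather than n + 1 makes the final
  -- contradiction strict.
  refine ⟨t ^ (n + 4) / (n + 2), by positivity, ?_⟩
  intro a₁ a₂ l₁ l₂ hl₁ hl₂ L hL hsup
  have hx : ((a₁, a₂) : ℝ × ℝ).1 ∈ Set.Ico a₁ (a₁ + l₁) := ⟨le_rfl, by simpa using hl₁⟩
  have hx' : ((a₁, a₂) : ℝ × ℝ).2 ∈ Set.Ico a₂ (a₂ + l₂) := ⟨le_rfl, by simpa using hl₂⟩
  have hcell : dyadicCell a₁ a₂ l₁ l₂ 0 (a₁, a₂) =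
      Set.Ico a₁ (a₁ + l₁) ×ˢ Set.Ico a₂ (a₂ + l₂) := by
    rw [dyadicCell, dyadicIco_zero hl₁ hx, dyadicIco_zero hl₂ hx']
  have hprim : ∀ W : IntSubspace n, ∃ (j : ℕ) (A : Fin j → ℝ[X]), IsIntFamily n A ∧
      Submodule.span ℝ (Set.range A) = W.1 ∧
      ∀ (k : ℕ) (C : Fin k → ℝ[X]), IsIntFamily n C →
        Submodule.span ℝ (Set.range C) = W.1 →
        ∀ L : ι → ℝ[X] →ₗ[ℝ] ℝ, minorNorm L A ≤ minorNorm L C := by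
    rintro ⟨_, j, A, hA, rfl⟩
    exact ⟨j, hA.exists_primitive ι⟩
  choose j A hA hAspan hAmin using hprim
  let ψ : IntSubspace n → ℝ × ℝ → ℝ := fun W z => minorNorm (fun c => L c z) (A W)
  have hpoly : ∀ W (f : Fin (j W) → ι),
      IsBiPolyFun ((n + 1) * d) fun z => minor (fun c => L c z) (A W) f := by
    intro W f
    refine (isBiPolyFun_det fun a b => ?_).mono (Nat.mul_le_mul_right d (hA W).card_le)
    exact hL (f b) (A W a) ((hA W).isIntPoly a).natDegree_le
  have hψcont : ∀ W, Continuous (ψ W) := fun W =>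
    (continuous_pi fun f => (hpoly W f).continuous).norm
  have hgood : ∀ W k x c, 0 < c → (∃ y ∈ dyadicCell a₁ a₂ l₁ l₂ k x, c ≤ ψ W y) →
      volume {y ∈ dyadicCell a₁ a₂ l₁ l₂ k x | ψ W y < t * c} ≤
        ENNReal.ofReal τ' * volume (dyadicCell a₁ a₂ l₁ l₂ k x) := by
    rintro W k x c hc ⟨y, hy, hcy⟩
    obtain ⟨f, hf⟩ : ∃ f : Fin (j W) → ι, c ≤ |minor (fun c => L c y) (A W) f| := by
      by_contra hno
      push Not at hno
      exact absurd hcy (not_le.2 ((pi_norm_lt_iff hc).2 hno))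
    have h := ht _ (hpoly W f) _ (l₁ / 2 ^ k) _ (l₂ / 2 ^ k) c (by positivity) (by positivity) hc
      ⟨y, hy, hf⟩
    refine (measure_mono ?_).trans h
    rintro z ⟨hz, hlt⟩
    exact ⟨hz, (abs_minor_le_minorNorm _ _ f).trans_lt hlt⟩
  have hdesc : ∀ W k x c, 0 < c → (∃ y ∈ dyadicCell a₁ a₂ l₁ l₂ k x, c ≤ ψ W y) →
      ∃ y ∈ dyadicCell a₁ a₂ l₁ l₂ (k + 1) x, t * c ≤ ψ W y := fun W k x c hc h =>
    exists_mem_dyadicCell_succ hl₁ hl₂ (lt_of_le_of_lt (min_le_left _ _) (by norm_num))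
      (hgood W k x c hc h)
  have hmain := measure_not_isMarked_le volume
    (isNestedPartition_dyadicCell (a₁ := a₁) (a₂ := a₂) hl₁ hl₂) ψ ht0 ht1
    (ENNReal.ofReal τ') (n + 2) hgood hdesc
    (fun W x c hx => exists_dyadicCell_subset hl₁ hl₂ (hψcont W) hx)
    card_le_of_isChain (a₁, a₂)
    (fun W => by rw [hcell]; exact hsup _ _ (hA W))
  rw [volume_dyadicCell hl₁, hcell, pow_zero, div_one] at hmain
  refine (measure_mono ?_).trans (hmain.trans ?_)
  · rintro x ⟨hxr, p, hp, hp0, hshort⟩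
    refine ⟨hxr, fun hmark => ?_⟩
    have hσ : 0 ≤ t ^ (n + 4) / ((n : ℝ) + 2) := by positivity
    have h := le_minorNorm_of_isMarked (fun c => L c x) (fun W => ψ W x)
      (fun W k B hB hspan => hAmin W k B hB hspan _)
      (fun W => ⟨j W, A W, hA W, hAspan W, rfl⟩) hmark hp hp0 hσ (fun c => (hshort c).le)
    have hpos : 0 < t ^ (n + 4) := by positivity
    have h2 : ((n : ℝ) + 1) * (t ^ (n + 4) / (n + 2)) < t ^ (n + 4) := by
      rw [← mul_div_assoc, div_lt_iff₀ (by positivity)]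
      nlinarith
    exact absurd h (not_le.2 h2)
  · rw [← ENNReal.ofReal_natCast, ← ENNReal.ofReal_mul (by positivity),
      ← ENNReal.ofReal_mul (by positivity)]
    apply ENNReal.ofReal_le_ofReal
    have : ((n + 2 + 1 : ℕ) : ℝ) * τ' ≤ τ := by
      have h3 : τ' ≤ τ / (n + 3) := min_le_right _ _
      rw [le_div_iff₀ (by positivity)] at h3
      push_cast
      linarith
    gcongr

/-! ### Lower bounds for the minors of the weighted functionals. -/

theorem castAdd_lt_natAdd {r k : ℕ} (a : Fin r) (i : Fin k) : Fin.castAdd k a < Fin.natAdd r i := by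
  rw [Fin.lt_def, Fin.val_castAdd, Fin.val_natAdd]
  omega

/-- Coefficients at the k top degrees vanish on the first r polynomials, so the matrix is block
triangular; the lower block is triangular with diagonal w. -/
theorem IsEchelon.minor_append {ι : Type*} {r k : ℕ} {R : Fin (r + k) → ℝ[X]} (hR : IsEchelon R)
    (L : ι → ℝ[X] →ₗ[ℝ] ℝ) (g : Fin r → ι) (f : Fin k → ι) {w : ℝ}
    (hf : ∀ i p, L (f i) p = w * p.coeff (R (Fin.natAdd r i)).natDegree) :
    minor L R (Fin.append g f) = minor L (fun a => R (Fin.castAdd k a)) g * w ^ k := by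
  rw [minor, ← Matrix.det_submatrix_equiv_self finSumFinEquiv, ← Matrix.fromBlocks_toBlocks
    ((Matrix.of fun a b => L (Fin.append g f b) (R a)).submatrix finSumFinEquiv finSumFinEquiv)]
  have h12 : ((Matrix.of fun a b => L (Fin.append g f b) (R a)).submatrix
      finSumFinEquiv finSumFinEquiv).toBlocks₁₂ = 0 := by
    ext a i
    simp only [Matrix.toBlocks₁₂, Matrix.of_apply, Matrix.submatrix_apply,
      finSumFinEquiv_apply_left, finSumFinEquiv_apply_right, Fin.append_right, Matrix.zero_apply, hf]
    rw [coeff_eq_zero_of_natDegree_lt, mul_zero]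
    exact hR.strictMono (castAdd_lt_natAdd _ _)
  rw [h12, Matrix.det_fromBlocks_zero₁₂]
  congr 1
  · rw [minor]
    congr 1
    ext a b
    simp [Matrix.toBlocks₁₁]
  · rw [Matrix.det_of_isLowerTriangular]
    · simp [Matrix.toBlocks₂₂, hf, fun i => (hR.monic i).coeff_natDegree]
    · intro a b hab
      simp only [Matrix.toBlocks₂₂, Matrix.of_apply, Matrix.submatrix_apply,
        finSumFinEquiv_apply_right, Fin.append_right, hf]
      rw [coeff_eq_zero_of_natDegree_lt, mul_zero]
      exact hR.strictMono ((Fin.natAdd_lt_natAdd_iff _).2 hab)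

theorem IsEchelon.natDegree_add_le {r k n : ℕ} {R : Fin (r + k) → ℝ[X]} (hR : IsEchelon R)
    (hn : ∀ i, (R i).natDegree ≤ n) (a : Fin r) : (R (Fin.castAdd k a)).natDegree + k ≤ n := by
  have h := Finset.card_le_card_of_injOn (s := (Finset.univ : Finset (Fin k)))
    (t := Finset.Ioc (R (Fin.castAdd k a)).natDegree n)
    (fun i => (R (Fin.natAdd r i)).natDegree)
    (fun i _ => Finset.mem_coe.2 (Finset.mem_Ioc.2
      ⟨hR.strictMono (castAdd_lt_natAdd _ _), hn _⟩))
    (fun i _ i' _ h => by simpa using hR.strictMono.injective h)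
  rw [Finset.card_univ, Fintype.card_fin, Nat.card_Ioc] at h
  have := hn (Fin.castAdd k a)
  omega

/-- The transition determinant is a nonzero integer. Lower bounds are therefore needed only for
echelon families, integral or not. -/
theorem IsIntFamily.exists_isEchelon_minorNorm_le {ι : Type*} [Fintype ι] {n j : ℕ}
    {A : Fin j → ℝ[X]} (hA : IsIntFamily n A) :
    ∃ R : Fin j → ℝ[X], IsEchelon R ∧ (∀ i, (R i).natDegree ≤ n) ∧
      ∀ L : ι → ℝ[X] →ₗ[ℝ] ℝ, minorNorm L R ≤ minorNorm L A := by
  obtain ⟨R, hR, hspan, hdeg⟩ := hA.exists_isEchelon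
  obtain ⟨z, hz, M, hM, h⟩ := hA.exists_det hR hspan.symm
  refine ⟨R, hR, hdeg, fun L => ?_⟩
  rw [minorNorm_eq_abs_det_mul L h, hM]
  refine le_mul_of_one_le_left (minorNorm_nonneg L R) ?_
  rw [← Int.cast_abs]
  exact_mod_cast Int.one_le_abs hz

/-- The determinant `p(x) q(y) - q(x) p(y)` is divisible by `x - y`, which bounds it from below on
a rectangle away from the diagonal. -/
theorem exists_le_abs_eval_sub {p q : ℝ[X]} (hp : p.Monic) (hq : q.Monic)
    (hpq : p.natDegree < q.natDegree) {n : ℕ} (hn : q.natDegree ≤ n) {u₁ u₂ l₁ l₂ ε : ℝ}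
    (hl₁ : 0 < l₁) (hl₂ : 0 < l₂)
    (hsep : ∀ x ∈ Set.Ioo u₁ (u₁ + l₁), ∀ y ∈ Set.Ioo u₂ (u₂ + l₂), ε ≤ |x - y|) :
    ∃ x ∈ Set.Ioo u₁ (u₁ + l₁), ∃ y ∈ Set.Ioo u₂ (u₂ + l₂),
      ε * (l₁ / (2 * n + 2)) ^ (q.natDegree - 1) * (l₂ / (2 * n + 2)) ^ p.natDegree ≤
        |p.eval x * q.eval y - q.eval x * p.eval y| := by
  obtain ⟨y, hy, hpy⟩ := exists_leadingCoeff_mul_le_abs_eval p (hpq.le.trans hn) u₂ hl₂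
  rw [hp.leadingCoeff, abs_one, one_mul] at hpy
  have hpy0 : 0 < |p.eval y| := lt_of_lt_of_le (by positivity) hpy
  -- As a polynomial in x with y fixed, the determinant has leading coefficient -p(y) and the root
  -- y. The quotient by X - y has degree one less than q and is large somewhere on the first
  -- interval.
  set F : ℝ[X] := C (q.eval y) * p - C (p.eval y) * q with hF
  have hFdeg : (C (q.eval y) * p).natDegree < (C (p.eval y) * q).natDegree := by
    rw [natDegree_C_mul (abs_pos.1 hpy0)]
    exact (natDegree_C_mul_le _ _).trans_lt hpq
  have hFlc : F.leadingCoeff = -p.eval y := by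
    rw [hF, leadingCoeff_sub_of_degree_lt' (degree_lt_degree hFdeg), leadingCoeff_mul,
      leadingCoeff_C, hq.leadingCoeff, mul_one]
  have hFnat : F.natDegree = q.natDegree := by
    rw [hF, natDegree_sub_eq_right_of_natDegree_lt hFdeg, natDegree_C_mul (abs_pos.1 hpy0)]
  have hroot : F.IsRoot y := by
    simp [hF, mul_comm]
  obtain ⟨G, hG⟩ := dvd_iff_isRoot.2 hroot
  have hGlc : G.leadingCoeff = -p.eval y := by
    rw [← hFlc, hG, leadingCoeff_mul, leadingCoeff_X_sub_C, one_mul]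
  have hG0 : G ≠ 0 := by
    rw [← leadingCoeff_ne_zero, hGlc]
    exact neg_ne_zero.2 (abs_pos.1 hpy0)
  have hGnat : G.natDegree = q.natDegree - 1 := by
    rw [← hFnat, hG, natDegree_mul (X_sub_C_ne_zero y) hG0, natDegree_X_sub_C]
    omega
  obtain ⟨x, hx, hGx⟩ := exists_leadingCoeff_mul_le_abs_eval G (n := n) (by omega) u₁ hl₁
  rw [hGlc, abs_neg, hGnat] at hGx
  refine ⟨x, hx, y, hy, ?_⟩
  have hFx : p.eval x * q.eval y - q.eval x * p.eval y = (x - y) * G.eval x := by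
    have := congrArg (eval x) hG
    simp only [hF, eval_sub, eval_mul, eval_C, eval_X] at this
    rw [← this]
    ring
  rw [hFx, abs_mul, mul_assoc]
  refine mul_le_mul (hsep x hx y hy) (le_trans ?_ hGx) (by positivity) (abs_nonneg _)
  rw [mul_comm]
  gcongr

/-- The weighted functionals `P(x)`, `P(y)`, `P'(s(x, y))` and the coefficients of `P`. -/
noncomputable def column (n : ℕ) (w₁ w₂ w₃ w₄ : ℝ) (s : ℝ × ℝ → ℝ) :
    Fin 3 ⊕ Fin (n + 1) → ℝ × ℝ → ℝ[X] →ₗ[ℝ] ℝ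
  | Sum.inl 0, z => w₁ • leval z.1
  | Sum.inl 1, z => w₂ • leval z.2
  | Sum.inl 2, z => w₃ • leval (s z) ∘ₗ derivative
  | Sum.inr i, _ => w₄ • lcoeff ℝ i

theorem isBiPolyFun_column {n : ℕ} (w₁ w₂ w₃ w₄ : ℝ) {s : ℝ × ℝ → ℝ}
    (hs : s = Prod.fst ∨ s = Prod.snd) (c : Fin 3 ⊕ Fin (n + 1)) (p : ℝ[X])
    (hp : p.natDegree ≤ n) : IsBiPolyFun n fun z => column n w₁ w₂ w₃ w₄ s c z p := by
  have hp' : (derivative p).natDegree ≤ n :=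
    (natDegree_derivative_le p).trans ((Nat.sub_le _ _).trans hp)
  rcases c with i | i
  · fin_cases i
    · exact (isBiPolyFun_eval_fst p hp).const_mul w₁
    · exact (isBiPolyFun_eval_snd p hp).const_mul w₂
    · rcases hs with rfl | rfl
      · exact (isBiPolyFun_eval_fst _ hp').const_mul w₃
      · exact (isBiPolyFun_eval_snd _ hp').const_mul w₃
  · exact isBiPolyFun_const n (w₄ * p.coeff i)

/-- A confluent Vandermonde determinant: column operations aside, it is that of 1, X, X² with values
at x and y and a derivative at one of them. -/
theorem abs_det_eval_eq {R : Fin 3 → ℝ[X]} (hR : ∀ i, (R i).Monic)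
    (hdeg : ∀ i, (R i).natDegree = i) {x y s : ℝ} (hs : s = x ∨ s = y) (w₁ w₂ w₃ : ℝ) :
    |(Matrix.of fun a b : Fin 3 => ![w₁ * (R a).eval x, w₂ * (R a).eval y,
      w₃ * (derivative (R a)).eval s] b).det| = |w₁ * w₂ * w₃| * (x - y) ^ 2 := by
  have h0 : R 0 = 1 := (hR 0).natDegree_eq_zero.1 (hdeg 0)
  have h1 : R 1 = X + C ((R 1).coeff 0) := (hR 1).eq_X_add_C (hdeg 1)
  have h2 : R 2 = X ^ 2 + C ((R 2).coeff 1) * X + C ((R 2).coeff 0) := by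
    have hlc : (R 2).coeff 2 = 1 := by
      have := (hR 2).coeff_natDegree
      rwa [hdeg 2] at this
    conv_lhs => rw [(R 2).as_sum_range_C_mul_X_pow, hdeg 2]
    simp [Finset.sum_range_succ, hlc]
    ring
  rw [Matrix.det_fin_three]
  simp only [Matrix.of_apply, Matrix.cons_val]
  rw [h0, h1, h2]
  simp only [derivative_add, derivative_mul, derivative_X_pow, derivative_C, derivative_X,
    derivative_one, eval_add, eval_mul, eval_X, eval_C, eval_one, eval_pow, eval_zero]
  rw [← abs_of_nonneg (sq_nonneg (x - y)), ← abs_mul]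
  rcases hs with rfl | rfl
  · rw [← abs_neg]
    congr 1
    norm_num
    ring
  · congr 1
    norm_num
    ring

/-- The rank j selects the minor: a single value for j = 1; P(x), P(y) and j - 2 top coefficients
for 2 ≤ j ≤ n; P(x), P(y), P'(s) and n - 2 coefficients for j = n + 1. The derivative is used only
in full rank. -/
theorem exists_one_le_minorNorm_column {n : ℕ} (hn : 2 ≤ n) {d₁ d₂ ε l₁ l₂ w₁ w₂ w₃ w₄ : ℝ}
    (hε : 0 < ε) (hl₁ : 0 < l₁) (hl₂ : 0 < l₂) (hw₁ : 0 < w₁) (hw₂ : 0 < w₂) (hw₃ : 0 < w₃)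
    (hw₄ : 0 < w₄)
    (hsep : ∀ x ∈ Set.Ioo (d₁ - l₁ / 2) (d₁ + l₁ / 2), ∀ y ∈ Set.Ioo (d₂ - l₂ / 2) (d₂ + l₂ / 2),
      ε ≤ |x - y|) {s : ℝ × ℝ → ℝ} (hs : s = Prod.fst ∨ s = Prod.snd)
    (hrank1 : ∀ k₁ k₂ : ℕ, k₁ + k₂ ≤ n →
      1 ≤ w₁ * ((min 1 ε / (4 * (n + 1))) ^ n * l₁ ^ k₁) ∨
      1 ≤ w₂ * ((min 1 ε / (4 * (n + 1))) ^ n * l₂ ^ k₂))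
    (hrank2 : ∀ k a b : ℕ, k + 2 ≤ n → a + 1 + k ≤ n → b ≤ a →
      1 ≤ w₁ * w₂ * w₄ ^ k * (ε * (l₁ / (2 * n + 2)) ^ a * (l₂ / (2 * n + 2)) ^ b))
    (hfull : 1 ≤ w₁ * w₂ * w₃ * w₄ ^ (n - 2) * ε ^ 2)
    (j : ℕ) (A : Fin j → ℝ[X]) (hA : IsIntFamily n A) :
    ∃ z ∈ Set.Ioo (d₁ - l₁ / 2) (d₁ + l₁ / 2) ×ˢ Set.Ioo (d₂ - l₂ / 2) (d₂ + l₂ / 2),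
      1 ≤ minorNorm (fun c => column n w₁ w₂ w₃ w₄ s c z) A := by
  have hd₁ : d₁ ∈ Set.Ioo (d₁ - l₁ / 2) (d₁ + l₁ / 2) := ⟨by linarith, by linarith⟩
  have hd₂ : d₂ ∈ Set.Ioo (d₂ - l₂ / 2) (d₂ + l₂ / 2) := ⟨by linarith, by linarith⟩
  have hjn := hA.card_le
  obtain rfl | rfl | hj2 : j = 0 ∨ j = 1 ∨ 2 ≤ j := by omega
  · exact ⟨(d₁, d₂), ⟨hd₁, hd₂⟩, (minorNorm_zero _ A).ge⟩
  · have hA0 : A 0 ≠ 0 := hA.linearIndependent.ne_zero 0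
    have hlc : 1 ≤ |(A 0).leadingCoeff| := by
      obtain ⟨z, hz⟩ := (hA.isIntPoly 0).exists_coeff (A 0).natDegree
      have hz0 : z ≠ 0 := by
        rintro rfl
        rw [coeff_natDegree, Int.cast_zero] at hz
        exact hA0 (leadingCoeff_eq_zero.1 hz)
      rw [← coeff_natDegree, hz, ← Int.cast_abs]
      exact_mod_cast Int.one_le_abs hz0
    have hle : ∀ c z, |column n w₁ w₂ w₃ w₄ s c z (A 0)| ≤
        minorNorm (fun c => column n w₁ w₂ w₃ w₄ s c z) A := by
      intro c z
      refine le_trans (le_of_eq ?_) (abs_minor_le_minorNorm _ A fun _ => c)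
      simp [minor]
    obtain ⟨k₁, k₂, hk, h1, h2⟩ := exists_orders_le_abs_eval (A 0) (hA.isIntPoly 0).natDegree_le
      hlc hε (hsep d₁ hd₁ d₂ hd₂)
    rcases hrank1 k₁ k₂ hk with h | h
    · obtain ⟨x, hx, hpx⟩ := h1 l₁ hl₁
      refine ⟨(x, d₂), ⟨hx, hd₂⟩, h.trans (le_trans ?_ (hle (Sum.inl 0) _))⟩
      change _ ≤ |w₁ * (A 0).eval x|
      rw [abs_mul, abs_of_pos hw₁]
      gcongr
    · obtain ⟨x, hx, hpx⟩ := h2 l₂ hl₂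
      refine ⟨(d₁, x), ⟨hd₁, hx⟩, h.trans (le_trans ?_ (hle (Sum.inl 1) _))⟩
      change _ ≤ |w₂ * (A 0).eval x|
      rw [abs_mul, abs_of_pos hw₂]
      gcongr
  obtain ⟨R, hR, hRn, hRA⟩ := hA.exists_isEchelon_minorNorm_le (ι := Fin 3 ⊕ Fin (n + 1))
  suffices h : ∃ z ∈ Set.Ioo (d₁ - l₁ / 2) (d₁ + l₁ / 2) ×ˢ Set.Ioo (d₂ - l₂ / 2) (d₂ + l₂ / 2),
      ∃ f, 1 ≤ |minor (fun c => column n w₁ w₂ w₃ w₄ s c z) R f| by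
    obtain ⟨z, hz, f, hf⟩ := h
    exact ⟨z, hz, hf.trans ((abs_minor_le_minorNorm _ R f).trans (hRA _))⟩
  obtain hjn' | hjn' : j ≤ n ∨ j = n + 1 := by omega
  · obtain ⟨k, rfl⟩ := Nat.exists_eq_add_of_le hj2
    have hlt : (R (Fin.castAdd k 0)).natDegree < (R (Fin.castAdd k 1)).natDegree :=
      hR.strictMono (by simp [Fin.lt_def])
    have hadd := hR.natDegree_add_le hRn 1
    have e1 : d₁ - l₁ / 2 + l₁ = d₁ + l₁ / 2 := by ring
    have e2 : d₂ - l₂ / 2 + l₂ = d₂ + l₂ / 2 := by ring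
    obtain ⟨x, hx, y, hy, hxy⟩ := exists_le_abs_eval_sub (hR.monic _) (hR.monic _) hlt (hRn _)
      (u₁ := d₁ - l₁ / 2) (u₂ := d₂ - l₂ / 2) hl₁ hl₂ (by rw [e1, e2]; exact hsep)
    rw [e1] at hx
    rw [e2] at hy
    refine ⟨(x, y), ⟨hx, hy⟩, Fin.append ![Sum.inl 0, Sum.inl 1]
      fun i => Sum.inr ⟨_, Nat.lt_succ_of_le (hRn (Fin.natAdd 2 i))⟩,
      (hrank2 k ((R (Fin.castAdd k 1)).natDegree - 1)
      (R (Fin.castAdd k 0)).natDegree (by omega) (by omega) (by omega)).trans ?_⟩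
    rw [hR.minor_append _ _ _ (w := w₄) (fun _ _ => rfl), minor]
    have : (Matrix.of fun a b : Fin 2 => column n w₁ w₂ w₃ w₄ s
          ((![Sum.inl 0, Sum.inl 1] : Fin 2 → Fin 3 ⊕ Fin (n + 1)) b) (x, y) (R (Fin.castAdd k a))) =
        Matrix.of fun a b : Fin 2 => ![w₁ * (R (Fin.castAdd k a)).eval x,
          w₂ * (R (Fin.castAdd k a)).eval y] b := by
      ext a b
      fin_cases b <;> rfl
    rw [this, Matrix.det_fin_two]
    simp only [Matrix.of_apply, Matrix.cons_val]
    rw [show ∀ p q r t : ℝ, w₁ * p * (w₂ * q) - w₂ * r * (w₁ * t) = w₁ * w₂ * (p * q - t * r) from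
      fun p q r t => by ring, abs_mul, abs_mul, abs_of_pos (mul_pos hw₁ hw₂),
      abs_of_pos (pow_pos hw₄ k), mul_right_comm]
    gcongr
  · obtain ⟨k, rfl⟩ : ∃ k, j = 3 + k := Nat.exists_eq_add_of_le (by omega)
    -- An echelon family of n + 1 members uses every degree from 0 to n.
    have hdeg : ∀ a : Fin 3, (R (Fin.castAdd k a)).natDegree = a := by
      have h0 := hR.natDegree_add_le hRn 0
      have h1 := hR.natDegree_add_le hRn 1
      have h2 := hR.natDegree_add_le hRn 2
      have h01 : (R (Fin.castAdd k 0)).natDegree < (R (Fin.castAdd k 1)).natDegree :=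
        hR.strictMono (by simp [Fin.lt_def])
      have h12 : (R (Fin.castAdd k 1)).natDegree < (R (Fin.castAdd k 2)).natDegree :=
        hR.strictMono (by simp [Fin.lt_def])
      intro a
      fin_cases a
      · change (R (Fin.castAdd k 0)).natDegree = 0
        omega
      · change (R (Fin.castAdd k 1)).natDegree = 1
        omega
      · change (R (Fin.castAdd k 2)).natDegree = 2
        omega
    refine ⟨(d₁, d₂), ⟨hd₁, hd₂⟩, Fin.append ![Sum.inl 0, Sum.inl 1, Sum.inl 2]
      fun i => Sum.inr ⟨_, Nat.lt_succ_of_le (hRn (Fin.natAdd 3 i))⟩, hfull.trans ?_⟩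
    rw [hR.minor_append _ _ _ (w := w₄) (fun _ _ => rfl), minor]
    have : (Matrix.of fun a b : Fin 3 => column n w₁ w₂ w₃ w₄ s
          ((![Sum.inl 0, Sum.inl 1, Sum.inl 2] : Fin 3 → Fin 3 ⊕ Fin (n + 1)) b) (d₁, d₂)
          (R (Fin.castAdd k a))) =
        Matrix.of fun a b : Fin 3 => ![w₁ * (R (Fin.castAdd k a)).eval d₁,
          w₂ * (R (Fin.castAdd k a)).eval d₂,
          w₃ * (derivative (R (Fin.castAdd k a))).eval (s (d₁, d₂))] b := by
      ext a b
      fin_cases b <;> rfl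
    have hs' : s (d₁, d₂) = d₁ ∨ s (d₁, d₂) = d₂ := by
      rcases hs with rfl | rfl
      · exact Or.inl rfl
      · exact Or.inr rfl
    rw [this, abs_mul, abs_det_eval_eq (fun a => hR.monic _) hdeg hs',
      abs_of_pos (by positivity : 0 < w₁ * w₂ * w₃), abs_of_pos (pow_pos hw₄ k),
      show n - 2 = k by omega, mul_right_comm, ← sq_abs (d₁ - d₂)]
    have := hsep d₁ hd₁ d₂ hd₂
    gcongr

/-! ### The conditions on the weights for large Q. -/

theorem eventually_one_le_mul_rpow {K E : ℝ} (hK : 0 < K) (hE : 0 ≤ E) (h0 : E = 0 → 1 ≤ K) :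
    ∀ᶠ Q : ℝ in Filter.atTop, 1 ≤ K * Q ^ E := by
  rcases hE.eq_or_lt with rfl | hE
  · exact Filter.Eventually.of_forall fun Q => by simpa using h0 rfl
  · exact ((tendsto_rpow_atTop hE).const_mul_atTop hK).eventually_ge_atTop 1

theorem rpow_mul_rpow_mul_pow {Q : ℝ} (hQ : 0 < Q) (v₁ v₂ s₁ s₂ : ℝ) (k a b : ℕ) :
    Q ^ v₁ * Q ^ v₂ * Q⁻¹ ^ k * (Q ^ (-s₁)) ^ a * (Q ^ (-s₂)) ^ b =
      Q ^ (v₁ + v₂ - k - s₁ * a - s₂ * b) := by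
  rw [← Real.rpow_neg_one, ← Real.rpow_natCast, ← Real.rpow_natCast, ← Real.rpow_natCast,
    ← Real.rpow_mul hQ.le, ← Real.rpow_mul hQ.le, ← Real.rpow_mul hQ.le, ← Real.rpow_add hQ,
    ← Real.rpow_add hQ, ← Real.rpow_add hQ, ← Real.rpow_add hQ]
  congr 1
  ring

/-- If k₁ or k₂ is 0, the matching Q^vᵢ suffices. Otherwise the product of the two quantities has
exponent (n-k₁-k₂) + (k₁-1)(1-s₁) + (k₂-1)(1-s₂) + (1-s₁-s₂), a sum of nonnegative terms. It
vanishes only if k₁ = k₂ = 1 and s₁ + s₂ = 1, and then c₁c₂ > c₀ decides. -/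
theorem eventually_one_le_of_orders {n : ℕ} {η κ c₀ s₁ s₂ v₁ v₂ c₁ c₂ : ℝ} (hη : 0 < η)
    (hκ : 0 < κ) (hK : 1 ≤ η ^ 2 * κ ^ 2 * c₀) (hs₁ : s₁ < 1) (hs₂ : s₂ < 1)
    (hs : s₁ + s₂ ≤ 1) (hv₁ : 0 < v₁) (hv₂ : 0 < v₂) (hv : v₁ + v₂ = (n : ℝ) - 1) (hc₁ : 0 < c₁)
    (hc₂ : 0 < c₂) (hc : s₁ + s₂ = 1 → c₀ < c₁ * c₂) {k₁ k₂ : ℕ} (hk : k₁ + k₂ ≤ n) :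
    ∀ᶠ Q : ℝ in Filter.atTop, 1 ≤ η * Q ^ v₁ * (κ * (c₁ * Q ^ (-s₁)) ^ k₁) ∨
      1 ≤ η * Q ^ v₂ * (κ * (c₂ * Q ^ (-s₂)) ^ k₂) := by
  rcases Nat.eq_zero_or_pos k₁ with rfl | hk₁
  · filter_upwards [eventually_one_le_mul_rpow (mul_pos hη hκ) hv₁.le (fun h => absurd h hv₁.ne')]
      with Q hQ
    left
    rw [pow_zero]
    linarith
  rcases Nat.eq_zero_or_pos k₂ with rfl | hk₂
  · filter_upwards [eventually_one_le_mul_rpow (mul_pos hη hκ) hv₂.le (fun h => absurd h hv₂.ne')]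
      with Q hQ
    right
    rw [pow_zero]
    linarith
  have hk₁' : (1 : ℝ) ≤ k₁ := by exact_mod_cast hk₁
  have hk₂' : (1 : ℝ) ≤ k₂ := by exact_mod_cast hk₂
  have hk' : (k₁ : ℝ) + k₂ ≤ n := by exact_mod_cast hk
  set E : ℝ := v₁ + v₂ - (0 : ℕ) - s₁ * k₁ - s₂ * k₂ with hE
  have hE' : E = (n - k₁ - k₂) + (k₁ - 1) * (1 - s₁) + (k₂ - 1) * (1 - s₂) + (1 - s₁ - s₂) := by
    rw [hE, hv]
    push_cast
    ring
  have t1 : 0 ≤ ((k₁ : ℝ) - 1) * (1 - s₁) := mul_nonneg (by linarith) (by linarith)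
  have t2 : 0 ≤ ((k₂ : ℝ) - 1) * (1 - s₂) := mul_nonneg (by linarith) (by linarith)
  have hev := eventually_one_le_mul_rpow (K := η ^ 2 * κ ^ 2 * (c₁ ^ k₁ * c₂ ^ k₂)) (E := E)
    (by positivity) (by linarith) (by
      intro h0
      have u1 : ((k₁ : ℝ) - 1) * (1 - s₁) = 0 := by linarith
      have u2 : ((k₂ : ℝ) - 1) * (1 - s₂) = 0 := by linarith
      have e1 : k₁ = 1 := by
        rcases mul_eq_zero.1 u1 with h | h
        · exact_mod_cast (by linarith : (k₁ : ℝ) = 1)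
        · linarith
      have e2 : k₂ = 1 := by
        rcases mul_eq_zero.1 u2 with h | h
        · exact_mod_cast (by linarith : (k₂ : ℝ) = 1)
        · linarith
      have hcc := hc (by linarith)
      rw [e1, e2, pow_one, pow_one]
      refine hK.trans ?_
      gcongr)
  filter_upwards [hev, Filter.eventually_gt_atTop 0] with Q hQ hQ0
  by_contra! hno
  rw [hE, ← rpow_mul_rpow_mul_pow hQ0] at hQ
  have hprod := mul_lt_one_of_nonneg_of_lt_one_left (by positivity) hno.1 hno.2.le
  refine absurd hQ (not_le.2 (lt_of_eq_of_lt ?_ hprod))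
  rw [mul_pow, mul_pow]
  ring

/-- The exponent is (n-1-k-a) + (a-b)(1-s₁) + b(1-s₁-s₂). If it vanishes, then a = b, and a = n - 1
- k is positive, so s₁ + s₂ = 1 and (c₁c₂)^a ≥ c₀. -/
theorem eventually_one_le_of_degrees {n : ℕ} {η ε c₀ s₁ s₂ v₁ v₂ c₁ c₂ : ℝ} (hη : 0 < η)
    (hη1 : η ≤ 1) (hε : 0 < ε) (hc₀ : 1 ≤ c₀) (hK : 1 ≤ η ^ n * ε * (1 / (2 * n + 2)) ^ (2 * n) * c₀)
    (hs₁ : s₁ < 1) (hs : s₁ + s₂ ≤ 1) (hv : v₁ + v₂ = (n : ℝ) - 1) (hc₁ : 0 < c₁)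
    (hc₂ : 0 < c₂) (hc : s₁ + s₂ = 1 → c₀ < c₁ * c₂) {k a b : ℕ} (hk : k + 2 ≤ n)
    (ha : a + 1 + k ≤ n) (hb : b ≤ a) :
    ∀ᶠ Q : ℝ in Filter.atTop, 1 ≤ η * Q ^ v₁ * (η * Q ^ v₂) * (η / Q) ^ k *
      (ε * (c₁ * Q ^ (-s₁) / (2 * n + 2)) ^ a * (c₂ * Q ^ (-s₂) / (2 * n + 2)) ^ b) := by
  have hk' : (k : ℝ) + 2 ≤ n := by exact_mod_cast hk
  have ha' : (a : ℝ) + 1 + k ≤ n := by exact_mod_cast ha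
  have hb' : (b : ℝ) ≤ a := by exact_mod_cast hb
  set E : ℝ := v₁ + v₂ - k - s₁ * a - s₂ * b with hE
  have hE' : E = (n - 1 - k - a) + (a - b) * (1 - s₁) + b * (1 - s₁ - s₂) := by
    rw [hE, hv]
    ring
  have t1 : 0 ≤ ((a : ℝ) - b) * (1 - s₁) := mul_nonneg (by linarith) (by linarith)
  have t2 : 0 ≤ (b : ℝ) * (1 - s₁ - s₂) := mul_nonneg (by positivity) (by linarith)
  have hr0 : (0 : ℝ) < 1 / (2 * n + 2) := by positivity
  have hr1 : (1 : ℝ) / (2 * n + 2) ≤ 1 := by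
    rw [div_le_one (by positivity)]
    linarith [(Nat.cast_nonneg n : (0 : ℝ) ≤ n)]
  have hev := eventually_one_le_mul_rpow
    (K := η ^ (2 + k) * ε * (1 / (2 * n + 2)) ^ (a + b) * (c₁ ^ a * c₂ ^ b)) (E := E)
    (by positivity) (by linarith) (by
      intro h0
      have u1 : ((a : ℝ) - b) * (1 - s₁) = 0 := by linarith
      have u2 : (b : ℝ) * (1 - s₁ - s₂) = 0 := by linarith
      have e1 : a = b := by
        rcases mul_eq_zero.1 u1 with h | h
        · exact_mod_cast (by linarith : (a : ℝ) = b)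
        · linarith
      subst e1
      have ha1 : a ≠ 0 := by
        rintro rfl
        push_cast at hE'
        linarith
      have hcc := hc (by
        rcases mul_eq_zero.1 u2 with h | h
        · exact absurd (by exact_mod_cast h) ha1
        · linarith)
      have hpow : c₀ ≤ c₁ ^ a * c₂ ^ a := by
        rw [← mul_pow]
        exact hcc.le.trans (le_self_pow₀ (hc₀.trans hcc.le) ha1)
      refine hK.trans ?_
      have i1 : η ^ n ≤ η ^ (2 + k) := pow_le_pow_of_le_one hη.le hη1 (by omega)
      have i2 : ((1 : ℝ) / (2 * n + 2)) ^ (2 * n) ≤ (1 / (2 * n + 2)) ^ (a + a) :=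
        pow_le_pow_of_le_one hr0.le hr1 (by omega)
      have : 0 ≤ c₀ := by linarith
      gcongr)
  filter_upwards [hev, Filter.eventually_gt_atTop 0] with Q hQ hQ0
  rw [hE, ← rpow_mul_rpow_mul_pow hQ0] at hQ
  refine hQ.trans (le_of_eq ?_)
  simp only [div_eq_mul_inv, mul_pow, one_mul]
  ring

/-! ### From small values and derivatives to short vectors, and the conclusion. -/

theorem natAbs_coeff_le_polyHeight (P : ℤ[X]) (i : ℕ) : (P.coeff i).natAbs ≤ polyHeight P := by
  by_cases hi : i ∈ Finset.range (P.natDegree + 1)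
  · exact Finset.le_sup (f := fun j => (P.coeff j).natAbs) hi
  · rw [coeff_eq_zero_of_natDegree_lt (by simpa [Nat.lt_succ_iff] using hi)]
    simp

theorem eval_map_intCast (P : ℤ[X]) (x : ℝ) :
    (P.map (Int.castRingHom ℝ)).eval x = aeval x P := by
  rw [← eval_map_algebraMap]
  rfl

theorem volume_prod_diff_eq_zero {I₁ I₂ : Set ℝ} {d₁ d₂ l₁ l₂ : ℝ} (h₁ : IsIntervalWith I₁ d₁ l₁)
    (h₂ : IsIntervalWith I₂ d₂ l₂) :
    volume ((I₁ ×ˢ I₂) \ (Set.Ico (d₁ - l₁ / 2) (d₁ - l₁ / 2 + l₁) ×ˢ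
      Set.Ico (d₂ - l₂ / 2) (d₂ - l₂ / 2 + l₂))) = 0 := by
  have hsub : (I₁ ×ˢ I₂) \ (Set.Ico (d₁ - l₁ / 2) (d₁ - l₁ / 2 + l₁) ×ˢ
      Set.Ico (d₂ - l₂ / 2) (d₂ - l₂ / 2 + l₂)) ⊆
      {d₁ + l₁ / 2} ×ˢ Set.univ ∪ Set.univ ×ˢ {d₂ + l₂ / 2} := by
    rintro ⟨x, y⟩ ⟨⟨hx, hy⟩, hno⟩
    have hx' := h₁.2 hx
    have hy' := h₂.2 hy
    by_contra hne
    simp only [Set.mem_union, Set.mem_prod, Set.mem_singleton_iff, Set.mem_univ, and_true,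
      true_and, not_or] at hne
    have hx2 := lt_of_le_of_ne hx'.2 hne.1
    have hy2 := lt_of_le_of_ne hy'.2 hne.2
    exact hno ⟨⟨hx'.1, by dsimp only; linarith⟩, ⟨hy'.1, by dsimp only; linarith⟩⟩
  refine measure_mono_null hsub (measure_union_null ?_ ?_) <;>
  · rw [Measure.volume_eq_prod, Measure.prod_prod]
    simp

theorem le_volume_prod {I₁ I₂ : Set ℝ} {d₁ d₂ l₁ l₂ : ℝ} (hl₁ : 0 < l₁)
    (h₁ : IsIntervalWith I₁ d₁ l₁) (h₂ : IsIntervalWith I₂ d₂ l₂) :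
    ENNReal.ofReal (l₁ * l₂) ≤ volume (I₁ ×ˢ I₂) := by
  have h := measure_mono (μ := volume) (Set.prod_mono h₁.1 h₂.1)
  rw [Measure.volume_eq_prod, Measure.prod_prod, Real.volume_Ioo, Real.volume_Ioo,
    ← ENNReal.ofReal_mul (by linarith)] at h
  refine le_trans (le_of_eq ?_) h
  congr 1
  ring

/-- The weights turn the bounds on values, derivative and height into the uniform bounds ηh, η and
η. The minimum of the two derivatives accounts for the two choices of s. -/
theorem smallDerivSet_diff_subset {n : ℕ} {Q h δ δ₀ η σ v₁ v₂ : ℝ} (hQ : 0 < Q) (hδ₀ : 0 < δ₀)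
    (hδ : δ ≤ δ₀) (hη : 0 < η) (hησ : η < σ) (hηh : η * h ≤ σ) (R J : Set (ℝ × ℝ)) :
    smallDerivSet n Q h δ v₁ v₂ R ⊆ (R \ J) ∪
      ({x ∈ J | ∃ p, IsIntPoly n p ∧ p ≠ 0 ∧ ∀ c, |column n (η * Q ^ v₁) (η * Q ^ v₂)
        (η / (δ₀ * Q)) (η / Q) Prod.fst c x p| < σ} ∪
      {x ∈ J | ∃ p, IsIntPoly n p ∧ p ≠ 0 ∧ ∀ c, |column n (η * Q ^ v₁) (η * Q ^ v₂)
        (η / (δ₀ * Q)) (η / Q) Prod.snd c x p| < σ}) := by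
  rintro x ⟨hxR, P, ⟨hPn, hPQ⟩, hP0, h1, h2, h3⟩
  by_cases hxJ : x ∉ J
  · exact Or.inl ⟨hxR, hxJ⟩
  rw [not_not] at hxJ
  right
  have hp0 : P.map (Int.castRingHom ℝ) ≠ 0 :=
    (Polynomial.map_ne_zero_iff (RingHom.injective_int _)).2 hP0
  have hval : ∀ v y : ℝ, |aeval y P| < h * Q ^ (-v) →
      |η * Q ^ v * (P.map (Int.castRingHom ℝ)).eval y| < σ := by
    intro v y hy
    rw [eval_map_intCast, abs_mul, abs_of_pos (by positivity)]
    calc η * Q ^ v * |aeval y P| < η * Q ^ v * (h * Q ^ (-v)) := by gcongr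
      _ = η * h * (Q ^ v * Q ^ (-v)) := by ring
      _ = η * h := by rw [← Real.rpow_add hQ, add_neg_cancel, Real.rpow_zero, mul_one]
      _ ≤ σ := hηh
  have hder : ∀ y : ℝ, |aeval y (derivative P)| < δ * Q →
      |η / (δ₀ * Q) * (derivative (P.map (Int.castRingHom ℝ))).eval y| < σ := by
    intro y hy
    rw [derivative_map, eval_map_intCast, abs_mul, abs_of_pos (by positivity)]
    have h4 : |aeval y (derivative P)| < δ₀ * Q := hy.trans_le (by gcongr)
    calc η / (δ₀ * Q) * |aeval y (derivative P)| ≤ η / (δ₀ * Q) * (δ₀ * Q) := by gcongr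
      _ = η := by field_simp
      _ < σ := hησ
  have hcoeff : ∀ i : ℕ, |η / Q * (P.map (Int.castRingHom ℝ)).coeff i| < σ := by
    intro i
    have h5 : |((P.coeff i : ℤ) : ℝ)| ≤ Q := by
      refine le_trans ?_ hPQ
      rw [← Int.cast_abs, ← Nat.cast_natAbs]
      exact_mod_cast natAbs_coeff_le_polyHeight P i
    rw [coeff_map, eq_intCast, abs_mul, abs_of_pos (by positivity)]
    calc η / Q * |((P.coeff i : ℤ) : ℝ)| ≤ η / Q * Q := by gcongr
      _ = η := by field_simp
      _ < σ := hησ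
  have hall : ∀ s : ℝ × ℝ → ℝ, |aeval (s x) (derivative P)| < δ * Q → ∀ c,
      |column n (η * Q ^ v₁) (η * Q ^ v₂) (η / (δ₀ * Q)) (η / Q) s c x
        (P.map (Int.castRingHom ℝ))| < σ := by
    rintro s hs (i | i)
    · fin_cases i
      · exact hval v₁ x.1 h1
      · exact hval v₂ x.2 h2
      · exact hder (s x) hs
    · exact hcoeff i
  rcases min_lt_iff.1 h3 with h3 | h3
  · exact Or.inl ⟨hxJ, _, ⟨P, hPn, rfl⟩, hp0, hall Prod.fst h3⟩
  · exact Or.inr ⟨hxJ, _, ⟨P, hPn, rfl⟩, hp0, hall Prod.snd h3⟩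

theorem lemma5 (n : ℕ) (hn : 2 ≤ n) (ε : ℝ) (hε : 0 < ε) (d₁ d₂ : ℝ) (h : ℝ) (hh : 0 < h) :
    ∃ c₀ > (0 : ℝ), ∃ δ₀ > (0 : ℝ),
      ∀ s₁ s₂ : ℝ, s₁ < 1 → s₂ < 1 → 0 < s₁ + s₂ → s₁ + s₂ ≤ 1 →
      ∀ v₁ v₂ : ℝ, 0 < v₁ → 0 < v₂ → v₁ + v₂ = (n : ℝ) - 1 →
      ∀ c₁ c₂ : ℝ, 0 < c₁ → 0 < c₂ → (s₁ + s₂ = 1 → c₀ < c₁ * c₂) →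
      ∃ Q₀ : ℝ, ∀ Q : ℝ, Q₀ < Q →
      ∀ I₁ I₂ : Set ℝ, IsIntervalWith I₁ d₁ (c₁ * Q ^ (-s₁)) →
        IsIntervalWith I₂ d₂ (c₂ * Q ^ (-s₂)) →
        (I₁ ×ˢ I₂) ∩ {x : ℝ × ℝ | |x.1 - x.2| < ε} = ∅ →
        ∀ δ : ℝ, δ ≤ δ₀ →
          volume (smallDerivSet n Q h δ v₁ v₂ (I₁ ×ˢ I₂)) < volume (I₁ ×ˢ I₂) / 4 := by
  -- Two exceptional sets, one for each s, of proportion 1/16 give 1/8 < 1/4.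
  obtain ⟨σ, hσ, hnondiv⟩ := exists_volume_short_le (Fin 3 ⊕ Fin (n + 1)) n n
    (show (0 : ℝ) < 1 / 16 by norm_num)
  set η : ℝ := min 1 (σ / (h + 2)) with hηdef
  have hη : 0 < η := by positivity
  have hη1 : η ≤ 1 := min_le_left _ _
  have hησ' : η * (h + 2) ≤ σ := (le_div_iff₀ (by positivity)).1 (min_le_right _ _)
  have hησ : η < σ := by nlinarith [mul_pos hη hh]
  have hηh : η * h ≤ σ := by nlinarith
  set κ : ℝ := (min 1 ε / (4 * (n + 1))) ^ n with hκdef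
  have hκ : 0 < κ := by positivity
  set K₁ : ℝ := η ^ 2 * κ ^ 2 with hK₁
  set K₂ : ℝ := η ^ n * ε * (1 / (2 * n + 2)) ^ (2 * n) with hK₂
  have hK₁0 : 0 < K₁ := by positivity
  have hK₂0 : 0 < K₂ := by positivity
  -- Large enough for the borderline exponent 0 in rank 1 (K₁) and in ranks 2 to n (K₂).
  set c₀ : ℝ := max 1 (max K₁⁻¹ K₂⁻¹) with hc₀def
  have hc₀ : 1 ≤ c₀ := le_max_left _ _
  have hK₁c : 1 ≤ K₁ * c₀ := by
    rw [← inv_le_iff_one_le_mul₀' hK₁0]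
    exact (le_max_left _ _).trans (le_max_right _ _)
  have hK₂c : 1 ≤ K₂ * c₀ := by
    rw [← inv_le_iff_one_le_mul₀' hK₂0]
    exact (le_max_right _ _).trans (le_max_right _ _)
  -- In full rank the product of the weights is η^(n+1)/δ₀, free of Q since v₁ + v₂ = n - 1; this
  -- choice makes its product with ε² equal to 1.
  set δ₀ : ℝ := η ^ (n + 1) * ε ^ 2 with hδ₀def
  have hδ₀ : 0 < δ₀ := by positivity
  refine ⟨c₀, by linarith, δ₀, hδ₀, ?_⟩
  intro s₁ s₂ hs₁ hs₂ _ hs v₁ v₂ hv₁ hv₂ hv c₁ c₂ hc₁ hc₂ hc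
  -- Only finitely many exponents occur, so one Q₀ serves them all.
  have hev1 : ∀ᶠ Q : ℝ in Filter.atTop, ∀ k : Fin (n + 1) × Fin (n + 1),
      (k.1 : ℕ) + k.2 ≤ n → 1 ≤ η * Q ^ v₁ * (κ * (c₁ * Q ^ (-s₁)) ^ (k.1 : ℕ)) ∨
        1 ≤ η * Q ^ v₂ * (κ * (c₂ * Q ^ (-s₂)) ^ (k.2 : ℕ)) := by
    rw [Filter.eventually_all]
    intro k
    by_cases hk : (k.1 : ℕ) + k.2 ≤ n
    · filter_upwards [eventually_one_le_of_orders hη hκ hK₁c hs₁ hs₂ hs hv₁ hv₂ hv hc₁ hc₂ hc hk]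
        with Q hQ _ using hQ
    · exact Filter.Eventually.of_forall fun Q h => absurd h hk
  have hev2 : ∀ᶠ Q : ℝ in Filter.atTop, ∀ k : Fin (n + 1) × Fin (n + 1) × Fin (n + 1),
      ((k.1 : ℕ) + 2 ≤ n ∧ (k.2.1 : ℕ) + 1 + k.1 ≤ n ∧ (k.2.2 : ℕ) ≤ k.2.1) →
      1 ≤ η * Q ^ v₁ * (η * Q ^ v₂) * (η / Q) ^ (k.1 : ℕ) *
        (ε * (c₁ * Q ^ (-s₁) / (2 * n + 2)) ^ (k.2.1 : ℕ) *
          (c₂ * Q ^ (-s₂) / (2 * n + 2)) ^ (k.2.2 : ℕ)) := by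
    rw [Filter.eventually_all]
    intro k
    by_cases hk : (k.1 : ℕ) + 2 ≤ n ∧ (k.2.1 : ℕ) + 1 + k.1 ≤ n ∧ (k.2.2 : ℕ) ≤ k.2.1
    · filter_upwards [eventually_one_le_of_degrees hη hη1 hε hc₀ hK₂c hs₁ hs hv hc₁ hc₂ hc
        hk.1 hk.2.1 hk.2.2] with Q hQ _ using hQ
    · exact Filter.Eventually.of_forall fun Q h => absurd h hk
  obtain ⟨Q₀, hQ₀⟩ := Filter.eventually_atTop.1
    ((hev1.and hev2).and (Filter.eventually_gt_atTop (0 : ℝ)))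
  refine ⟨Q₀, fun Q hQ I₁ I₂ hI₁ hI₂ hdisj δ hδ => ?_⟩
  obtain ⟨⟨hr1, hr2⟩, hQ0⟩ := hQ₀ Q hQ.le
  set l₁ : ℝ := c₁ * Q ^ (-s₁) with hl₁def
  set l₂ : ℝ := c₂ * Q ^ (-s₂) with hl₂def
  have hl₁ : 0 < l₁ := by positivity
  have hl₂ : 0 < l₂ := by positivity
  have hsep : ∀ x ∈ Set.Ioo (d₁ - l₁ / 2) (d₁ + l₁ / 2),
      ∀ y ∈ Set.Ioo (d₂ - l₂ / 2) (d₂ + l₂ / 2), ε ≤ |x - y| := by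
    intro x hx y hy
    by_contra hlt
    have hmem : (x, y) ∈ (I₁ ×ˢ I₂) ∩ {x : ℝ × ℝ | |x.1 - x.2| < ε} :=
      ⟨⟨hI₁.1 hx, hI₂.1 hy⟩, not_le.1 hlt⟩
    rw [hdisj] at hmem
    exact hmem
  have hfull : 1 ≤ η * Q ^ v₁ * (η * Q ^ v₂) * (η / (δ₀ * Q)) * (η / Q) ^ (n - 2) * ε ^ 2 := by
    obtain ⟨m, rfl⟩ : ∃ m, n = m + 2 := ⟨n - 2, by omega⟩
    have hpow : Q ^ v₁ * Q ^ v₂ = Q ^ (m + 1) := by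
      rw [← Real.rpow_add hQ0, hv, ← Real.rpow_natCast]
      congr 1
      push_cast
      ring
    refine le_of_eq ?_
    rw [show η * Q ^ v₁ * (η * Q ^ v₂) = η ^ 2 * (Q ^ v₁ * Q ^ v₂) by ring, hpow, hδ₀def,
      show m + 2 - 2 = m by omega, div_pow]
    field_simp
    ring
  have hbound : ∀ s : ℝ × ℝ → ℝ, s = Prod.fst ∨ s = Prod.snd →
      volume {x ∈ Set.Ico (d₁ - l₁ / 2) (d₁ - l₁ / 2 + l₁) ×ˢ
        Set.Ico (d₂ - l₂ / 2) (d₂ - l₂ / 2 + l₂) | ∃ p, IsIntPoly n p ∧ p ≠ 0 ∧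
        ∀ c, |column n (η * Q ^ v₁) (η * Q ^ v₂) (η / (δ₀ * Q)) (η / Q) s c x p| < σ} ≤
      ENNReal.ofReal (1 / 16 * (l₁ * l₂)) := by
    intro s hs'
    refine hnondiv _ _ l₁ l₂ hl₁ hl₂ _ (isBiPolyFun_column _ _ _ _ hs') fun j A hA => ?_
    obtain ⟨z, hz, hzA⟩ := exists_one_le_minorNorm_column hn hε hl₁ hl₂
      (w₁ := η * Q ^ v₁) (w₂ := η * Q ^ v₂) (w₃ := η / (δ₀ * Q)) (w₄ := η / Q)
      (by positivity) (by positivity) (by positivity) (by positivity) hsep hs'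
      (fun k₁ k₂ hk => hr1 (⟨k₁, by omega⟩, ⟨k₂, by omega⟩) hk)
      (fun k a b hk ha hb => hr2 (⟨k, by omega⟩, ⟨a, by omega⟩, ⟨b, by omega⟩) ⟨hk, ha, hb⟩)
      hfull j A hA
    exact ⟨z, ⟨⟨hz.1.1.le, by linarith [hz.1.2]⟩, ⟨hz.2.1.le, by linarith [hz.2.2]⟩⟩, hzA⟩
  have hpos : 0 < l₁ * l₂ := by positivity
  calc volume (smallDerivSet n Q h δ v₁ v₂ (I₁ ×ˢ I₂))
      ≤ 0 + (ENNReal.ofReal (1 / 16 * (l₁ * l₂)) + ENNReal.ofReal (1 / 16 * (l₁ * l₂))) := by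
        refine (measure_mono (smallDerivSet_diff_subset hQ0 hδ₀ hδ hη hησ hηh _ _)).trans
          ((measure_union_le _ _).trans (add_le_add (volume_prod_diff_eq_zero hI₁ hI₂).le
            ((measure_union_le _ _).trans (add_le_add (hbound _ (Or.inl rfl))
              (hbound _ (Or.inr rfl))))))
    _ = ENNReal.ofReal (l₁ * l₂ / 8) := by
        rw [zero_add, ← ENNReal.ofReal_add (by positivity) (by positivity)]
        congr 1
        ring
    _ < ENNReal.ofReal (l₁ * l₂ / 4) :=
        (ENNReal.ofReal_lt_ofReal_iff (by positivity)).2 (by linarith)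
    _ = ENNReal.ofReal (l₁ * l₂) / 4 := by
        rw [ENNReal.ofReal_div_of_pos (by norm_num), ENNReal.ofReal_ofNat]
    _ ≤ volume (I₁ ×ˢ I₂) / 4 := by
        gcongr
        exact le_volume_prod hl₁ hI₁ hI₂
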